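/- All graphs are finite. A \emph{cycle-tree} is an embedded planar graph $H$ such that the vertices incident to the outer face induce a chordless cycle (the outer cycle, which is allowed to be a $2$-gon, i.e. two parallel edges; otherwise $H$ is simple) and the remaining vertices induce a (non-empty) tree. A cycle-tree with one edge of the outer cycle removed is a \emph{path-tree}; its vertices on the former outer cycle are its \emph{path vertices}, the other ones its \emph{tree vertices}. A graph is \emph{$3$-connected} if it is connected and has no cutvertex and no separation pair, i.e. deleting at most two vertices never disconnects it (so a triangle counts as $3$-connected). An \emph{almost-triconnected path-tree} with root $\rho$, leftmost path vertex $\ell$ and rightmost path vertex $r$ is a path-tree $G$ that has in one of its faces a tree vertex $\rho$ and path vertices $\ell$ and $r$, such that adding inside this face the edge $\ell r$, and the edges $\rho\ell$ and $\rho r$ unless they are already present, yields a $3$-connected cycle-tree with the same path vertices on its outer cycle and the same tree vertices. (If $\ell$ and $r$ are the only path vertices, the added edge $\ell r$ is parallel to the edge $\ell r$ of $G$.) An \emph{SPQ-decomposition} of $G$ is a finite rooted tree whose nodes $\mu$ are Q-, S- and P-nodes, where each node $\mu$ is associated with a graph $G_\mu$ whose vertices are divided into tree vertices and path vertices and which has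 a root $\rho_\mu$ (a tree vertex), a leftmost path vertex $\ell_\mu$ and a rightmost path vertex $r_\mu$, the root node being associated with $G,\rho,\ell,r$, such that: - Q-node (a leaf): $G_\mu$ has exactly three vertices, the tree vertex $\rho_\mu$ and the path vertices $\ell_\mu\neq r_\mu$; the edge $\ell_\mu r_\mu$ exists, and each of the edges $\rho_\mu\ell_\mu$, $\rho_\mu r_\mu$ may or may not exist. - S-node (exactly one child, associated with $T_1$ with root $\rho_1$, leftmost path vertex $\ell_1$ and rightmost path vertex $r_1$): $G_\mu$ is obtained from $T_1$ by adding a new tree vertex $\rho_\mu$, the edge $\rho_\mu\rho_1$, and possibly one or both of the edges $\rho_\mu\ell_1$, $\rho_\mu r_1$; moreover $\ell_\mu=\ell_1$ and $r_\mu=r_1$. - P-node (children associated with $T_1,\dots,T_k$, $k\ge 2$, where $T_i$ has root $\rho_i$, leftmost path vertex $\ell_i$ and rightmost path vertex $r_i$): $G_\mu$ is obtained from the disjoint union of $T_1,\dots,T_k$ by identifying all roots $\rho_i$ into one root $\rho_\mu$ and identifying $r_i$ with $\ell_{i+1}$ for $i=1,\dots,k-1$ (parallel edges that arise are merged); moreover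 $\ell_\mu=\ell_1$ and $r_\mu=r_k$. \textbf{Lemma.} Every almost-triconnected path-tree $G$ with root $\rho$, leftmost path vertex $\ell$ and rightmost path vertex $r$ admits an SPQ-decomposition. -/

import Mathlib

universe u

/-- A finite multigraph with vertex set `V` together with a combinatorial embedding (rotation
system). Every edge consists of two opposite darts `d`, `rev d`; the dart `d` leaves the vertex
`src d`. The permutation `rot` lists the darts leaving each vertex in their circular order. -/
structure EmbeddedMultigraph (V : Type u) where
  Dart : Type
  finite_dart : Finite Dart
  src : Dart → V
  rev : Dart → Dart
  rev_rev : ∀ d, rev (rev d) = d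
  rev_ne : ∀ d, rev d ≠ d
  rot : Equiv.Perm Dart
  sameCycle_rot : ∀ d e, rot.SameCycle d e ↔ src d = src e

namespace EmbeddedMultigraph

variable {V : Type u} (H : EmbeddedMultigraph V)

/-- The end vertex of a dart. -/
def tgt (d : H.Dart) : V := H.src (H.rev d)

/-- The underlying simple graph. -/
def toSimple : SimpleGraph V where
  Adj u v := u ≠ v ∧ ∃ d, H.src d = u ∧ H.tgt d = v
  symm := ⟨by
    rintro u v ⟨hne, d, hu, hv⟩
    exact ⟨hne.symm, H.rev d, hv, by rw [tgt, H.rev_rev]; exact hu⟩⟩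
  loopless := ⟨fun u h => h.1 rfl⟩

/-- Walking along a face, the dart after `a` is `rot (rev a)`. The classes of `faceSetoid S` are the
faces of the embedded graph obtained by deleting the edges in `S` (a set of darts): deleting an edge
merges the faces on its two sides. A dart `d`, deleted or not, stands for a corner at `src d`. -/
def faceSetoid (S : Set H.Dart) : Setoid H.Dart :=
  Relation.EqvGen.setoid fun a b => b = H.rot (H.rev a) ∨ (a ∈ S ∧ b = H.rev a)

/-- The faces of the embedded graph obtained by deleting the edges in `S`. -/
def FaceAfterDeleting (S : Set H.Dart) : Type := Quotient (H.faceSetoid S)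

/-- The faces of `H`. -/
abbrev Face : Type := H.FaceAfterDeleting ∅

/-- The face to which (the corner of) a dart belongs. -/
def faceOf (S : Set H.Dart) (d : H.Dart) : H.FaceAfterDeleting S :=
  Quotient.mk (H.faceSetoid S) d

/-- The vertex `v` is incident to the face `F`. -/
def Incident {S : Set H.Dart} (v : V) (F : H.FaceAfterDeleting S) : Prop :=
  ∃ d, H.src d = v ∧ H.faceOf S d = F

/-- The embedding is an embedding of a connected graph in the plane (sphere): Euler's formula
`|V| + |F| = |E| + 2` holds, where `2 |E|` is the number of darts. -/
def IsConnectedPlane : Prop :=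
  H.toSimple.Connected ∧ 2 * (Nat.card V + Nat.card H.Face) = Nat.card H.Dart + 4

/-- Connected, without a cutvertex and without a separation pair: no set of at most two vertices
disconnects the graph. -/
def IsThreeConnected : Prop :=
  ∀ s : Set V, s.ncard ≤ 2 → (H.toSimple.induce sᶜ).Preconnected

/-- The first level: the set of vertices incident to the outer face. -/
def outerLevel (outer : H.Face) : Set V := {v | H.Incident v outer}

/-- `H` with outer face `outer` is a cycle-tree: the outer level induces a chordless cycle (a
connected loopless multigraph in which every vertex has degree two; the cycle is allowed to be a
`2`-gon) and the remaining vertices induce a tree. Two edges are parallel only if they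
form the outer `2`-gon. -/
structure IsCycleTree (outer : H.Face) : Prop where
  plane : H.IsConnectedPlane
  loopless : ∀ d, H.src d ≠ H.tgt d
  parallel : ∀ d e, H.src d = H.src e → H.tgt d = H.tgt e → d ≠ e →
    H.src d ∈ H.outerLevel outer ∧ H.tgt d ∈ H.outerLevel outer
  cycle_connected : (H.toSimple.induce (H.outerLevel outer)).Connected
  cycle_degree : ∀ v ∈ H.outerLevel outer,
    Nat.card {d // H.src d = v ∧ H.tgt d ∈ H.outerLevel outer} = 2
  tree : (H.toSimple.induce (H.outerLevel outer)ᶜ).IsTree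

end EmbeddedMultigraph

/-- The data of a path-tree with a root: a graph living on the vertices `treeVerts ∪ pathVerts`
of an ambient vertex type, with a root, a leftmost and a rightmost path vertex. -/
structure PathTreeData (V : Type u) where
  treeVerts : Set V
  pathVerts : Set V
  graph : SimpleGraph V
  root : V
  left : V
  right : V

namespace PathTreeData

variable {V : Type u}

/-- `G` is an almost-triconnected path-tree: there is an embedded `3`-connected cycle-tree `H`, with
the path vertices of `G` on the outer cycle and the tree vertices of `G` inside, such that `H` arises
from `G` by adding, inside a single face `F` of `G` that contains the root `ρ`, the leftmost path
vertex `ℓ` and the rightmost path vertex `r`, the edges `ρℓ`, `ρr`, `ℓr`. Here `S` is the set of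
(darts of) added edges and `e` is the added edge `ℓr`; `ρℓ` and `ρr` need not be added if `G` already
has them, whereas `e` is always added (and is parallel to the edge `ℓr` of `G` if there are only two
path vertices). -/
def IsAlmostTriconnected (G : PathTreeData V) : Prop :=
  ∃ (H : EmbeddedMultigraph V) (outer : H.Face) (S : Set H.Dart) (e : H.Dart)
    (F : H.FaceAfterDeleting S),
    H.IsCycleTree outer ∧ H.IsThreeConnected ∧
    -- tree vertices, path vertices and the three marked vertices
    G.pathVerts = H.outerLevel outer ∧ G.treeVerts = (H.outerLevel outer)ᶜ ∧
    G.root ∈ G.treeVerts ∧ G.left ∈ G.pathVerts ∧ G.right ∈ G.pathVerts ∧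
    -- `H` contains the three edges
    H.toSimple.Adj G.root G.left ∧ H.toSimple.Adj G.root G.right ∧
    H.src e = G.left ∧ H.tgt e = G.right ∧
    -- the added edges
    (∀ d ∈ S, H.rev d ∈ S) ∧ e ∈ S ∧
    (∀ d ∈ S, d = e ∨ d = H.rev e ∨
      s(H.src d, H.tgt d) = s(G.root, G.left) ∨ s(H.src d, H.tgt d) = s(G.root, G.right)) ∧
    -- `G` is `H` without the added edges
    (∀ u v, G.graph.Adj u v ↔ ∃ d, d ∉ S ∧ H.src d = u ∧ H.tgt d = v) ∧
    -- the face of `G` in which the edges are added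
    H.Incident G.root F ∧ H.Incident G.left F ∧ H.Incident G.right F ∧ (∀ d ∈ S, H.faceOf S d = F)

/-- A Q-node: three vertices, one tree vertex (the root) and two path vertices `left`, `right`. The
edge between `left` and `right` exists, the two other edges may or may not exist. -/
structure IsQNode (X : PathTreeData V) : Prop where
  left_ne_right : X.left ≠ X.right
  root_ne_left : X.root ≠ X.left
  root_ne_right : X.root ≠ X.right
  treeVerts_eq : X.treeVerts = {X.root}
  pathVerts_eq : X.pathVerts = {X.left, X.right}
  adj_left_right : X.graph.Adj X.left X.right
  mem_of_adj : ∀ u v, X.graph.Adj u v → u ∈ X.treeVerts ∪ X.pathVerts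

/-- An S-node `X` with child `T`: a new root is added and connected to the root of `T` and
to an arbitrary set `N` of the vertices `left`, `right`. -/
structure IsSNode (X T : PathTreeData V) : Prop where
  root_notMem : X.root ∉ T.treeVerts ∪ T.pathVerts
  treeVerts_eq : X.treeVerts = insert X.root T.treeVerts
  pathVerts_eq : X.pathVerts = T.pathVerts
  left_eq : X.left = T.left
  right_eq : X.right = T.right
  adj_iff : ∃ N ⊆ ({T.left, T.right} : Set V), ∀ u v, X.graph.Adj u v ↔
    T.graph.Adj u v ∨ (u = X.root ∧ (v = T.root ∨ v ∈ N)) ∨ (v = X.root ∧ (u = T.root ∨ u ∈ N))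

/-- A P-node `X` with children `T 0, …, T (n + 1)` from left to right: all roots are identified, and
the rightmost path vertex of each child is identified with the leftmost path vertex of the next
one. The children are placed in the ambient vertex type so that they share exactly the identified
vertices. -/
structure IsPNode (X : PathTreeData V) {n : ℕ} (T : Fin (n + 2) → PathTreeData V) : Prop where
  root_eq : ∀ i, (T i).root = X.root
  right_eq_left : ∀ i : Fin (n + 1), (T i.castSucc).right = (T i.succ).left
  left_eq : X.left = (T 0).left
  right_eq : X.right = (T (Fin.last (n + 1))).right
  treeVerts_eq : X.treeVerts = ⋃ i, (T i).treeVerts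
  pathVerts_eq : X.pathVerts = ⋃ i, (T i).pathVerts
  graph_eq : X.graph = ⨆ i, (T i).graph
  tree_inter_tree : ∀ i j, i ≠ j → (T i).treeVerts ∩ (T j).treeVerts = {X.root}
  tree_inter_path : ∀ i j, (T i).treeVerts ∩ (T j).pathVerts = ∅
  path_inter_path_next : ∀ i : Fin (n + 1),
    (T i.castSucc).pathVerts ∩ (T i.succ).pathVerts = {(T i.castSucc).right}
  path_inter_path : ∀ i j : Fin (n + 2), (i : ℕ) + 1 < j → (T i).pathVerts ∩ (T j).pathVerts = ∅

end PathTreeData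

/-- An SPQ-decomposition of `X`: a rooted tree of Q-, S- and P-nodes, each associated with a graph,
whose root node is associated with `X`. -/
inductive SPQDecomposition {V : Type u} : PathTreeData V → Type u
  | qNode (X : PathTreeData V) (hX : X.IsQNode) : SPQDecomposition X
  | sNode (X T : PathTreeData V) (hX : X.IsSNode T) (t : SPQDecomposition T) : SPQDecomposition X
  | pNode (X : PathTreeData V) (n : ℕ) (T : Fin (n + 2) → PathTreeData V) (hX : X.IsPNode T)
      (t : ∀ i, SPQDecomposition (T i)) : SPQDecomposition X

/-! Root the tree at `ρ` and number the path vertices `p 0, …, p N` along the outer cycle, from one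
end of the added edge `ℓr` to the other. The attachments of the subtree below a tree vertex `c ≠ ρ`
span an interval of indices. `IsNoncrossing` records three facts: each such interval has two
distinct ends, no tree vertex outside the subtree is adjacent to a path vertex strictly inside its
interval, and the intervals of disjoint subtrees share no path edge.

Given these facts, the decomposition is pure combinatorics on the graphs `piece v a b`. A child of
`v` spanning all of `[a, b]` gives an S-node. Without one, an interval of length one gives a Q-node,
and a longer interval has an interior index that no child of the piece straddles, which gives a
P-node with two children. The induction is on the size of the subtree and then on `b - a`.

Planarity enters through `exists_face_coloring`: by Euler's formula, every mod 2 cycle is the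
boundary of a set of faces. In `IsOuterWalk.separation` this is applied to a cycle through a subtree
and back along the path between two of its attachments. The root lies on the inner face at the added
edge (`exists_dart_inner_face`), so the root, and every tree vertex reachable from it outside the
subtree, is on the same side as the outer face. That each interval has two ends is 3-connectedness:
otherwise the parent of `c` and a single attachment would cut off the subtree. -/

/-! ### Rooted trees described by parent functions. -/

/-- The vertices of `T` from which iterating `par` leads to `c`. -/
def descendants {V : Type u} (T : Set V) (par : V → V) (c : V) : Set V :=
  {u | u ∈ T ∧ ∃ k, par^[k] u = c}

/-- `par` and `dep` are the parent function and the depth of the tree that `G` induces on `T`,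
rooted at `ρ`. -/
structure IsParentFunction {V : Type u} (G : SimpleGraph V) (T : Set V) (ρ : V) (par : V → V)
    (dep : V → ℕ) : Prop where
  root_mem : ρ ∈ T
  par_root : par ρ = ρ
  par_mem : ∀ v ∈ T, par v ∈ T
  dep_eq : ∀ v ∈ T, v ≠ ρ → dep v = dep (par v) + 1
  adj_iff : ∀ u ∈ T, ∀ v ∈ T, G.Adj u v ↔ (u ≠ ρ ∧ par u = v) ∨ (v ≠ ρ ∧ par v = u)

namespace IsParentFunction

variable {V : Type u} {G : SimpleGraph V} {T : Set V} {ρ : V} {par : V → V} {dep : V → ℕ}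

theorem self_mem {c : V} (hc : c ∈ T) : c ∈ descendants T par c := ⟨hc, 0, rfl⟩

theorem par_mem_descendants (h : IsParentFunction G T ρ par dep) {c u : V}
    (hu : u ∈ descendants T par c) (hne : u ≠ c) : par u ∈ descendants T par c := by
  obtain ⟨huT, k, hk⟩ := hu
  cases k with
  | zero => exact absurd hk hne
  | succ k => exact ⟨h.par_mem u huT, k, by simpa using hk⟩

theorem mem_of_par_mem {c u : V} (huT : u ∈ T)
    (hu : par u ∈ descendants T par c) : u ∈ descendants T par c := by
  obtain ⟨-, k, hk⟩ := hu
  exact ⟨huT, k + 1, by simpa using hk⟩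

theorem iterate_root (h : IsParentFunction G T ρ par dep) (k : ℕ) : par^[k] ρ = ρ :=
  Function.iterate_fixed h.par_root k

/-- The root is a fixed point of `par`, so the number of steps to `c` is determined only for `c ≠
ρ`. Comparing depths then shows that sibling subtrees are disjoint. -/
theorem dep_iterate (h : IsParentFunction G T ρ par dep) {c : V} (hc : c ≠ ρ) :
    ∀ (k : ℕ) {u : V}, u ∈ T → par^[k] u = c → dep u = dep c + k := by
  intro k
  induction k with
  | zero => rintro u - rfl; rfl
  | succ k ih =>
    intro u hu hk
    have hne : u ≠ ρ := by
      rintro rfl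
      exact hc (by rw [← hk, h.iterate_root])
    rw [h.dep_eq u hu hne, ih (h.par_mem u hu) (by simpa using hk)]
    omega

theorem eq_of_mem_descendants (h : IsParentFunction G T ρ par dep) {c c' u : V} (hcT : c ∈ T)
    (hcT' : c' ∈ T) (hc : c ≠ ρ) (hc' : c' ≠ ρ) (hp : par c = par c')
    (hu : u ∈ descendants T par c) (hu' : u ∈ descendants T par c') : c = c' := by
  obtain ⟨huT, k, hk⟩ := hu
  obtain ⟨-, k', hk'⟩ := hu'
  have h1 := h.dep_iterate hc k huT hk
  have h2 := h.dep_iterate hc' k' huT hk'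
  have h3 := h.dep_eq c hcT hc
  have h4 := h.dep_eq c' hcT' hc'
  rw [hp] at h3
  obtain rfl : k = k' := by omega
  rw [← hk, ← hk']

theorem exists_child (h : IsParentFunction G T ρ par dep) {v u : V} (hu : u ∈ descendants T par v)
    (hne : u ≠ v) : ∃ c ∈ T, c ≠ ρ ∧ par c = v ∧ u ∈ descendants T par c := by
  obtain ⟨huT, k, hk⟩ := hu
  have hT : ∀ k, par^[k] u ∈ T := by
    intro k
    induction k with
    | zero => exact huT
    | succ k ih => rw [Function.iterate_succ_apply']; exact h.par_mem _ ih
  induction k with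
  | zero => exact absurd hk hne
  | succ k ih =>
    by_cases hv : par^[k] u = v
    · exact ih hv
    · rw [Function.iterate_succ_apply'] at hk
      refine ⟨par^[k] u, hT k, ?_, hk, huT, k, rfl⟩
      intro hρ
      rw [hρ, h.par_root] at hk
      exact hv (hρ.trans hk)

theorem par_notMem_descendants (h : IsParentFunction G T ρ par dep) {c : V} (hcT : c ∈ T)
    (hc : c ≠ ρ) : par c ∉ descendants T par c := by
  rintro ⟨hT, k, hk⟩
  have h1 := h.dep_iterate hc k hT hk
  have h2 := h.dep_eq c hcT hc
  omega

theorem root_notMem_descendants (h : IsParentFunction G T ρ par dep) {c : V}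
    (hc : c ≠ ρ) : ρ ∉ descendants T par c := by
  rintro ⟨-, k, hk⟩
  rw [h.iterate_root] at hk
  exact hc hk.symm

theorem descendants_subset {c v : V} (hp : par c = v) :
    descendants T par c ⊆ descendants T par v := by
  rintro u ⟨hT, k, hk⟩
  exact ⟨hT, k + 1, by rw [Function.iterate_succ_apply', hk, hp]⟩

theorem eq_child_of_adj (h : IsParentFunction G T ρ par dep) {c w : V} (hcT : c ∈ T)
    (hc : c ≠ ρ) (hw : w ∈ descendants T par c) (ha : G.Adj (par c) w) : w = c := by
  obtain ⟨hwT, k, hk⟩ := hw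
  have h1 := h.dep_iterate hc k hwT hk
  have h2 := h.dep_eq c hcT hc
  rcases (h.adj_iff _ (h.par_mem c hcT) _ hwT).1 ha with ⟨h3, h4⟩ | ⟨h3, h4⟩
  · have h5 := h.dep_eq _ (h.par_mem c hcT) h3
    rw [h4] at h5
    omega
  · have h5 := h.dep_eq _ hwT h3
    rw [h4] at h5
    obtain rfl : k = 0 := by omega
    exact hk

/-- A subtree is joined to the rest of the tree by one edge only, so its neighbourhood consists of
`par c` and its attachments. This is the candidate separator used against 3-connectedness. -/
theorem eq_of_adj_of_notMem (h : IsParentFunction G T ρ par dep) {c u w : V}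
    (hu : u ∈ descendants T par c) (hw : w ∈ T) (hwc : w ∉ descendants T par c)
    (ha : G.Adj u w) : u = c ∧ w = par c := by
  rcases (h.adj_iff _ hu.1 _ hw).1 ha with ⟨h3, h4⟩ | ⟨h3, h4⟩
  · by_cases huc : u = c
    · subst huc; exact ⟨rfl, h4.symm⟩
    · exact absurd (h4 ▸ h.par_mem_descendants hu huc) hwc
  · exact absurd (mem_of_par_mem hw (h4.symm ▸ hu)) hwc

theorem not_adj_of_siblings (h : IsParentFunction G T ρ par dep) {c c' u w : V} (hcT : c ∈ T)
    (hcT' : c' ∈ T) (hc : c ≠ ρ) (hc' : c' ≠ ρ) (hp : par c = par c') (hne : c ≠ c')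
    (hu : u ∈ descendants T par c) (hw : w ∈ descendants T par c') : ¬ G.Adj u w := by
  intro ha
  have h1 := h.eq_of_adj_of_notMem hu hw.1
    (fun hw' => hne (h.eq_of_mem_descendants hcT hcT' hc hc' hp hw' hw)) ha
  rw [h1.2, hp] at hw
  exact h.par_notMem_descendants hcT' hc' hw

theorem exists_iterate_eq_root (h : IsParentFunction G T ρ par dep) :
    ∀ (n : ℕ) {u : V}, dep u = n → u ∈ T → ∃ k, par^[k] u = ρ := by
  intro n
  induction n with
  | zero =>
    intro u hn hu
    by_contra! hcon
    have := h.dep_eq u hu (hcon 0)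
    omega
  | succ n ih =>
    intro u hn hu
    by_cases hne : u = ρ
    · exact ⟨0, hne⟩
    · obtain ⟨k, hk⟩ := ih (by have := h.dep_eq u hu hne; omega) (h.par_mem u hu)
      exact ⟨k + 1, by simpa using hk⟩

theorem descendants_root (h : IsParentFunction G T ρ par dep) : descendants T par ρ = T :=
  Set.Subset.antisymm (fun _ hu => hu.1) fun _ hu => ⟨hu, h.exists_iterate_eq_root _ rfl hu⟩

end IsParentFunction

/-! ### Noncrossing attachments and the decomposition of pieces. -/

/-- The indices of the path vertices `p 0, …, p N` adjacent to a descendant of `c`. -/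
def attachments {V : Type u} (G : SimpleGraph V) (T : Set V) (par : V → V) (p : ℕ → V) (N : ℕ)
    (c : V) : Set ℕ :=
  {i | i ≤ N ∧ ∃ u ∈ descendants T par c, G.Adj u (p i)}

/-- A rooted tree together with a path `p 0, …, p N` such that the attachments of the
subtrees do not cross. -/
structure IsNoncrossing {V : Type u} (G : SimpleGraph V) (T : Set V) (ρ : V) (par : V → V)
    (dep : V → ℕ) (p : ℕ → V) (N : ℕ) : Prop extends IsParentFunction G T ρ par dep where
  path_inj : ∀ i ≤ N, ∀ j ≤ N, p i = p j → i = j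
  path_notMem : ∀ i ≤ N, p i ∉ T
  path_adj : ∀ i ≤ N, ∀ j ≤ N, G.Adj (p i) (p j) ↔ i + 1 = j ∨ j + 1 = i
  exists_lt : ∀ c ∈ T, c ≠ ρ →
    ∃ i ∈ attachments G T par p N c, ∃ j ∈ attachments G T par p N c, i < j
  noncrossing : ∀ c ∈ T, c ≠ ρ → ∀ i ∈ attachments G T par p N c,
    ∀ k ∈ attachments G T par p N c, ∀ j, i < j → j < k →
    ∀ u ∈ T, u ∉ descendants T par c → ¬ G.Adj u (p j)
  -- The index `j` stands for the path edge from `p j` to `p (j + 1)`; the half-open inequalities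
  -- allow disjoint subtrees to share an end of their intervals.
  disjoint : ∀ c ∈ T, c ≠ ρ → ∀ c' ∈ T, c' ≠ ρ →
    Disjoint (descendants T par c) (descendants T par c') →
    ∀ i ∈ attachments G T par p N c, ∀ k ∈ attachments G T par p N c,
    ∀ i' ∈ attachments G T par p N c', ∀ k' ∈ attachments G T par p N c',
    ∀ j, i ≤ j → j < k → i' ≤ j → ¬ j < k'

namespace IsNoncrossing

variable {V : Type u} {G : SimpleGraph V} {T : Set V} {ρ : V} {par : V → V} {dep : V → ℕ}
  {p : ℕ → V} {N : ℕ}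

/-- The first attachment of the subtree at `c`. -/
noncomputable def lo (G : SimpleGraph V) (T : Set V) (par : V → V) (p : ℕ → V) (N : ℕ) (c : V) :
    ℕ := sInf (attachments G T par p N c)

/-- The last attachment of the subtree at `c`. -/
noncomputable def hi (G : SimpleGraph V) (T : Set V) (par : V → V) (p : ℕ → V) (N : ℕ) (c : V) :
    ℕ := sSup (attachments G T par p N c)

local notation "loc" => lo G T par p N
local notation "hic" => hi G T par p N
local notation "att" => attachments G T par p N
local notation "desc" => descendants T par

theorem bddAbove_attachments (c : V) : BddAbove (att c) := ⟨N, fun _ hi => hi.1⟩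

theorem lo_le {c : V} {i : ℕ} (hi : i ∈ att c) : loc c ≤ i := Nat.sInf_le hi

theorem le_hi {c : V} {i : ℕ} (hi : i ∈ att c) : i ≤ hic c := le_csSup (bddAbove_attachments c) hi

theorem lo_mem (h : IsNoncrossing G T ρ par dep p N) {c : V} (hc : c ∈ T) (hne : c ≠ ρ) :
    loc c ∈ att c := by
  obtain ⟨i, hi, -⟩ := h.exists_lt c hc hne
  exact Nat.sInf_mem ⟨i, hi⟩

theorem hi_mem (h : IsNoncrossing G T ρ par dep p N) {c : V} (hc : c ∈ T) (hne : c ≠ ρ) :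
    hic c ∈ att c := by
  obtain ⟨i, hi, -⟩ := h.exists_lt c hc hne
  exact Nat.sSup_mem ⟨i, hi⟩ (bddAbove_attachments c)

theorem lo_lt_hi (h : IsNoncrossing G T ρ par dep p N) {c : V} (hc : c ∈ T) (hne : c ≠ ρ) :
    loc c < hic c := by
  obtain ⟨i, hi, j, hj, hij⟩ := h.exists_lt c hc hne
  exact (lo_le hi).trans_lt (hij.trans_le (le_hi hj))

theorem attachments_subset {c v : V} (hp : par c = v) : att c ⊆ att v :=
  fun _ ⟨hi, u, hu, ha⟩ => ⟨hi, u, IsParentFunction.descendants_subset hp hu, ha⟩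

/-- `c` is a child of `v` whose attachments all lie in `[a, b]`. -/
def ChildIn (G : SimpleGraph V) (T : Set V) (ρ : V) (par : V → V) (p : ℕ → V) (N : ℕ)
    (v : V) (a b : ℕ) (c : V) : Prop :=
  c ∈ T ∧ c ≠ ρ ∧ par c = v ∧ a ≤ lo G T par p N c ∧ hi G T par p N c ≤ b

/-- The vertex `v` with the subtrees of its children attached inside `[a, b]`. -/
def branches (G : SimpleGraph V) (T : Set V) (ρ : V) (par : V → V) (p : ℕ → V) (N : ℕ)
    (v : V) (a b : ℕ) : Set V :=
  insert v {u | ∃ c, ChildIn G T ρ par p N v a b c ∧ u ∈ descendants T par c}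

/-- The part of `G` that consists of `branches v a b` and the path from `p a` to `p b`. -/
def piece (G : SimpleGraph V) (T : Set V) (ρ : V) (par : V → V) (p : ℕ → V) (N : ℕ)
    (v : V) (a b : ℕ) : PathTreeData V where
  treeVerts := branches G T ρ par p N v a b
  pathVerts := p '' Set.Icc a b
  graph :=
    { Adj := fun x y => G.Adj x y ∧ x ∈ branches G T ρ par p N v a b ∪ p '' Set.Icc a b ∧
        y ∈ branches G T ρ par p N v a b ∪ p '' Set.Icc a b
      symm := ⟨fun _ _ hxy => ⟨hxy.1.symm, hxy.2.2, hxy.2.1⟩⟩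
      loopless := ⟨fun x hx => G.loopless.irrefl x hx.1⟩ }
  root := v
  left := p a
  right := p b

local notation "brs" => branches G T ρ par p N
local notation "pc" => piece G T ρ par p N
local notation "chi" => ChildIn G T ρ par p N

theorem ChildIn.mono {v c : V} {a b a' b' : ℕ} (h : chi v a b c) (ha : a' ≤ a) (hb : b ≤ b') :
    chi v a' b' c := ⟨h.1, h.2.1, h.2.2.1, ha.trans h.2.2.2.1, h.2.2.2.2.trans hb⟩

theorem branches_mono {v : V} {a b a' b' : ℕ} (ha : a' ≤ a) (hb : b ≤ b') :
    brs v a b ⊆ brs v a' b' := by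
  rintro u (rfl | ⟨c, hc, hu⟩)
  · exact Or.inl rfl
  · exact Or.inr ⟨c, hc.mono ha hb, hu⟩

theorem branches_subset {v : V} (hv : v ∈ T) (a b : ℕ) : brs v a b ⊆ desc v := by
  rintro u (rfl | ⟨c, hc, hu⟩)
  · exact IsParentFunction.self_mem hv
  · exact IsParentFunction.descendants_subset hc.2.2.1 hu

theorem branches_eq (h : IsNoncrossing G T ρ par dep p N) {v : V} {a b : ℕ} (hv : v ∈ T)
    (hab : ∀ i ∈ att v, a ≤ i ∧ i ≤ b) : brs v a b = desc v := by
  refine (branches_subset hv a b).antisymm fun u hu => ?_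
  by_cases huv : u = v
  · exact Or.inl huv
  · obtain ⟨c, hcT, hc, hp, huc⟩ := h.exists_child hu huv
    exact Or.inr ⟨c, ⟨hcT, hc, hp, (hab _ (attachments_subset hp (h.lo_mem hcT hc))).1,
      (hab _ (attachments_subset hp (h.hi_mem hcT hc))).2⟩, huc⟩

/-- Siblings have disjoint subtrees, so at most one child covers a given path edge. -/
theorem child_unique (h : IsNoncrossing G T ρ par dep p N) {v c c' : V} {j : ℕ}
    (hc : c ∈ T ∧ c ≠ ρ ∧ par c = v) (hc' : c' ∈ T ∧ c' ≠ ρ ∧ par c' = v)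
    (h1 : loc c ≤ j) (h2 : j < hic c) (h1' : loc c' ≤ j) (h2' : j < hic c') : c = c' := by
  by_contra hne
  refine h.disjoint c hc.1 hc.2.1 c' hc'.1 hc'.2.1 ?_ _ (h.lo_mem hc.1 hc.2.1) _
    (h.hi_mem hc.1 hc.2.1) _ (h.lo_mem hc'.1 hc'.2.1) _ (h.hi_mem hc'.1 hc'.2.1) j h1 h2 h1' h2'
  rw [Set.disjoint_left]
  intro u hu hu'
  exact hne (h.eq_of_mem_descendants hc.1 hc'.1 hc.2.1 hc'.2.1 (hc.2.2.trans hc'.2.2.symm) hu hu')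

theorem isQNode_piece (h : IsNoncrossing G T ρ par dep p N) {v : V} {a : ℕ} (hv : v ∈ T)
    (ha : a + 1 ≤ N) (hno : ∀ c, ¬ chi v a (a + 1) c) : (pc v a (a + 1)).IsQNode := by
  have hIcc : Set.Icc a (a + 1) = {a, a + 1} := by
    ext i; simp only [Set.mem_Icc, Set.mem_insert_iff, Set.mem_singleton_iff]; omega
  refine ⟨?_, ?_, ?_, ?_, ?_, ?_, ?_⟩
  · intro heq
    have := h.path_inj a (by omega) (a + 1) ha heq
    omega
  · intro heq
    have heq' : v = p a := heq
    exact h.path_notMem a (by omega) (heq' ▸ hv)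
  · intro heq
    have heq' : v = p (a + 1) := heq
    exact h.path_notMem (a + 1) ha (heq' ▸ hv)
  · refine Set.Subset.antisymm ?_ (fun u hu => Or.inl hu)
    rintro u (rfl | ⟨c, hc, -⟩)
    · rfl
    · exact absurd hc (hno c)
  · simp only [piece, hIcc, Set.image_pair]
  · refine ⟨(h.path_adj a (by omega) (a + 1) ha).2 (Or.inl rfl), Or.inr ⟨a, by simp, rfl⟩,
      Or.inr ⟨a + 1, by simp, rfl⟩⟩
  · exact fun x y hxy => hxy.2.1

/-- Since `c` covers every path edge of `[a, b]`, no other child fits into the piece. By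
noncrossing, `v` sees no path vertex strictly between `p a` and `p b`, so its only possible
neighbours in the piece are `c`, `p a` and `p b`. -/
theorem isSNode_piece (h : IsNoncrossing G T ρ par dep p N) {v c : V} {a b : ℕ} (hv : v ∈ T)
    (hb : b ≤ N) (hc : c ∈ T) (hne : c ≠ ρ) (hp : par c = v) (hlo : loc c = a) (hhi : hic c = b) :
    (pc v a b).IsSNode (pc c a b) := by
  have hmem : ∀ i ∈ att c, a ≤ i ∧ i ≤ b := fun i hi => ⟨hlo ▸ lo_le hi, hhi ▸ le_hi hi⟩
  have hbc : brs c a b = desc c := h.branches_eq hc hmem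
  have hbv : brs v a b = insert v (desc c) := by
    refine Set.Subset.antisymm ?_ ?_
    · rintro u (rfl | ⟨c', hc', hu⟩)
      · exact Or.inl rfl
      · have hlt := h.lo_lt_hi hc'.1 hc'.2.1
        have := hc'.2.2.2
        -- The path edge starting at `loc c'` is covered by both children.
        obtain rfl : c = c' := h.child_unique (j := loc c') ⟨hc, hne, hp⟩
          ⟨hc'.1, hc'.2.1, hc'.2.2.1⟩ (by omega) (by omega) le_rfl hlt
        exact Or.inr hu
    · rintro u (rfl | hu)
      · exact Or.inl rfl
      · exact Or.inr ⟨c, ⟨hc, hne, hp, hlo.ge, hhi.le⟩, hu⟩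
  have hvc : v ∉ desc c := hp ▸ h.par_notMem_descendants hc hne
  have hvp : v ∉ p '' Set.Icc a b := by
    rintro ⟨i, hi, rfl⟩
    exact h.path_notMem i (hi.2.trans hb) hv
  have hnb : ∀ y, G.Adj v y → y ∈ desc c ∪ p '' Set.Icc a b → y = c ∨ y = p a ∨ y = p b := by
    rintro y hy (hyc | ⟨i, hi, rfl⟩)
    · exact Or.inl (h.eq_child_of_adj hc hne hyc (hp.symm ▸ hy))
    · right
      by_contra! hcon
      have h1 : i ≠ a := fun h' => hcon.1 (h' ▸ rfl)
      have h2 : i ≠ b := fun h' => hcon.2 (h' ▸ rfl)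
      have hi' := Set.mem_Icc.1 hi
      exact h.noncrossing c hc hne _ (h.lo_mem hc hne) _ (h.hi_mem hc hne) i (by omega) (by omega)
        v hv hvc hy
  have hab : a ≤ b := by have := h.lo_lt_hi hc hne; omega
  have hadj : G.Adj v c := (h.adj_iff v hv c hc).2 (Or.inr ⟨hne, hp⟩)
  have hcc : c ∈ desc c := IsParentFunction.self_mem hc
  refine ⟨?_, ?_, rfl, rfl, rfl, {y | (y = p a ∨ y = p b) ∧ G.Adj v y}, ?_, ?_⟩
  · simp only [piece, hbc]
    rintro (h' | h')
    exacts [hvc h', hvp h']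
  · simp only [piece, hbc, hbv]
  · rintro y ⟨hy, -⟩
    exact hy
  · have key : ∀ y, (G.Adj v y ∧ y ∈ insert v (desc c) ∪ p '' Set.Icc a b) ↔
        y = c ∨ ((y = p a ∨ y = p b) ∧ G.Adj v y) := by
      intro y
      constructor
      · rintro ⟨hy, (rfl | hyc) | hyp⟩
        · exact absurd hy (G.loopless.irrefl _)
        · exact (hnb y hy (Or.inl hyc)).imp id fun h' => ⟨h', hy⟩
        · exact (hnb y hy (Or.inr hyp)).imp id fun h' => ⟨h', hy⟩
      · rintro (rfl | ⟨rfl | rfl, hy⟩)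
        · exact ⟨hadj, Or.inl (Or.inr hcc)⟩
        · exact ⟨hy, Or.inr ⟨a, ⟨le_rfl, hab⟩, rfl⟩⟩
        · exact ⟨hy, Or.inr ⟨b, ⟨hab, le_rfl⟩, rfl⟩⟩
    have hvW : v ∈ insert v (desc c) ∪ p '' Set.Icc a b := Or.inl (Or.inl rfl)
    intro x y
    simp only [piece, hbc, hbv]
    constructor
    · rintro ⟨hxy, hx, hy⟩
      by_cases hxv : x = v
      · subst hxv
        exact Or.inr (Or.inl ⟨rfl, (key y).1 ⟨hxy, hy⟩⟩)
      by_cases hyv : y = v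
      · subst hyv
        exact Or.inr (Or.inr ⟨rfl, (key x).1 ⟨hxy.symm, hx⟩⟩)
      · refine Or.inl ⟨hxy, ?_, ?_⟩
        · exact hx.imp (fun h' => h'.resolve_left hxv) id
        · exact hy.imp (fun h' => h'.resolve_left hyv) id
    · rintro (⟨hxy, hx, hy⟩ | ⟨rfl, hy⟩ | ⟨rfl, hx⟩)
      · exact ⟨hxy, hx.imp Or.inr id, hy.imp Or.inr id⟩
      · obtain ⟨h1, h2⟩ := (key y).2 hy
        exact ⟨h1, hvW, h2⟩
      · obtain ⟨h1, h2⟩ := (key x).2 hx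
        exact ⟨h1.symm, h2, hvW⟩

/-- No child straddles `j`, so each child subtree goes entirely to the left or to the right part,
and no edge is lost in the split. Binary P-nodes suffice. -/
theorem isPNode_piece (h : IsNoncrossing G T ρ par dep p N) {v : V} {a b j : ℕ} (hv : v ∈ T)
    (hb : b ≤ N) (haj : a < j) (hjb : j < b)
    (hj : ∀ c, chi v a b c → hic c ≤ j ∨ j ≤ loc c) :
    (pc v a b).IsPNode (n := 0) ![pc v a j, pc v j b] := by
  have hmemP : ∀ {i : ℕ} {s t : ℕ}, i ≤ N → t ≤ N → p i ∈ p '' Set.Icc s t → s ≤ i ∧ i ≤ t := by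
    rintro i s t hi ht ⟨k, hk, hki⟩
    obtain rfl := h.path_inj k (hk.2.trans ht) i hi hki
    exact hk
  have hbr : brs v a b = brs v a j ∪ brs v j b := by
    refine Set.Subset.antisymm ?_ (Set.union_subset (branches_mono le_rfl hjb.le)
      (branches_mono haj.le le_rfl))
    rintro u (rfl | ⟨c, hc, hu⟩)
    · exact Or.inl (Or.inl rfl)
    · rcases hj c hc with h1 | h1
      · exact Or.inl (Or.inr ⟨c, ⟨hc.1, hc.2.1, hc.2.2.1, hc.2.2.2.1, h1⟩, hu⟩)
      · exact Or.inr (Or.inr ⟨c, ⟨hc.1, hc.2.1, hc.2.2.1, h1, hc.2.2.2.2⟩, hu⟩)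
  have hIcc : Set.Icc a b = Set.Icc a j ∪ Set.Icc j b :=
    (Set.Icc_union_Icc_eq_Icc haj.le hjb.le).symm
  have hTT : brs v a j ∩ brs v j b = {v} := by
    refine Set.Subset.antisymm ?_ ?_
    · rintro u ⟨rfl | ⟨c, hc, hu⟩, h2⟩
      · rfl
      rcases h2 with rfl | ⟨c', hc', hu'⟩
      · rfl
      obtain rfl := h.eq_of_mem_descendants hc.1 hc'.1 hc.2.1 hc'.2.1
        (hc.2.2.1.trans hc'.2.2.1.symm) hu hu'
      have h1 := h.lo_lt_hi hc.1 hc.2.1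
      have h2 := hc.2.2.2
      have h3 := hc'.2.2.2
      omega
    · rintro u rfl
      exact ⟨Or.inl rfl, Or.inl rfl⟩
  have hTP : ∀ s t s' t' : ℕ, t' ≤ N → brs v s t ∩ p '' Set.Icc s' t' = ∅ := by
    intro s t s' t' ht'
    rw [Set.eq_empty_iff_forall_notMem]
    rintro u ⟨hu, i, hi, rfl⟩
    exact h.path_notMem i (hi.2.trans ht') (branches_subset hv s t hu).1
  have hPP : p '' Set.Icc a j ∩ p '' Set.Icc j b = {p j} := by
    refine Set.Subset.antisymm ?_ ?_
    · rintro u ⟨⟨i, hi, rfl⟩, hu⟩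
      have h1 := hmemP (by have := hi.2; omega) hb hu
      obtain rfl : i = j := le_antisymm hi.2 h1.1
      rfl
    · rintro u rfl
      exact ⟨⟨j, ⟨haj.le, le_rfl⟩, rfl⟩, ⟨j, ⟨le_rfl, hjb.le⟩, rfl⟩⟩
  have tree_path : ∀ x y, x ∈ brs v a b → y ∈ p '' Set.Icc a b → G.Adj x y →
      (pc v a j).graph.Adj x y ∨ (pc v j b).graph.Adj x y := by
    rintro x y hx ⟨i, hi, rfl⟩ hxy
    have hi' := Set.mem_Icc.1 hi
    have hL : i ≤ j → p i ∈ p '' Set.Icc a j := fun h' => ⟨i, ⟨hi'.1, h'⟩, rfl⟩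
    have hR : j ≤ i → p i ∈ p '' Set.Icc j b := fun h' => ⟨i, ⟨h', hi'.2⟩, rfl⟩
    rcases hx with rfl | ⟨c, hc, hx⟩
    · rcases le_total i j with h1 | h1
      · exact Or.inl ⟨hxy, Or.inl (Or.inl rfl), Or.inr (hL h1)⟩
      · exact Or.inr ⟨hxy, Or.inl (Or.inl rfl), Or.inr (hR h1)⟩
    · have hat : i ∈ att c := ⟨by omega, x, hx, hxy⟩
      rcases hj c hc with h1 | h1
      · exact Or.inl ⟨hxy, Or.inl (Or.inr ⟨c, ⟨hc.1, hc.2.1, hc.2.2.1, hc.2.2.2.1, h1⟩, hx⟩),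
          Or.inr (hL ((le_hi hat).trans h1))⟩
      · exact Or.inr ⟨hxy, Or.inl (Or.inr ⟨c, ⟨hc.1, hc.2.1, hc.2.2.1, h1, hc.2.2.2.2⟩, hx⟩),
          Or.inr (hR (h1.trans (lo_le hat)))⟩
  have hgraph : ∀ x y, (pc v a b).graph.Adj x y ↔
      (pc v a j).graph.Adj x y ∨ (pc v j b).graph.Adj x y := by
    intro x y
    constructor
    · rintro ⟨hxy, hx | hx, hy | hy⟩
      · have hroot : ∀ {x y}, x = v → y ∈ brs v a b → G.Adj x y →
            (pc v a j).graph.Adj x y ∨ (pc v j b).graph.Adj x y := by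
          rintro x y rfl hy hxy
          rw [hbr] at hy
          exact hy.imp (fun h' => ⟨hxy, Or.inl (Or.inl rfl), Or.inl h'⟩)
            fun h' => ⟨hxy, Or.inl (Or.inl rfl), Or.inl h'⟩
        rcases id hx with hxv | ⟨c, hc, hxc⟩
        · exact hroot hxv hy hxy
        rcases id hy with hyv | ⟨c', hc', hyc⟩
        · exact (hroot hyv hx hxy.symm).imp (fun h' => h'.symm) fun h' => h'.symm
        obtain rfl : c = c' := by
          by_contra hne
          exact h.not_adj_of_siblings hc.1 hc'.1 hc.2.1 hc'.2.1
            (hc.2.2.1.trans hc'.2.2.1.symm) hne hxc hyc hxy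
        rcases hj c hc with h1 | h1
        · have h2 : chi v a j c := ⟨hc.1, hc.2.1, hc.2.2.1, hc.2.2.2.1, h1⟩
          exact Or.inl ⟨hxy, Or.inl (Or.inr ⟨c, h2, hxc⟩), Or.inl (Or.inr ⟨c, h2, hyc⟩)⟩
        · have h2 : chi v j b c := ⟨hc.1, hc.2.1, hc.2.2.1, h1, hc.2.2.2.2⟩
          exact Or.inr ⟨hxy, Or.inl (Or.inr ⟨c, h2, hxc⟩), Or.inl (Or.inr ⟨c, h2, hyc⟩)⟩
      · exact tree_path x y hx hy hxy
      · exact (tree_path y x hy hx hxy.symm).imp (fun h' => h'.symm) fun h' => h'.symm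
      · obtain ⟨i, hi, rfl⟩ := hx
        obtain ⟨k, hk, rfl⟩ := hy
        have hi' := Set.mem_Icc.1 hi
        have hk' := Set.mem_Icc.1 hk
        have h1 := (h.path_adj i (by omega) k (by omega)).1 hxy
        have h2 : (i ≤ j ∧ k ≤ j) ∨ (j ≤ i ∧ j ≤ k) := by omega
        refine h2.imp (fun h3 => ⟨hxy, ?_, ?_⟩) fun h3 => ⟨hxy, ?_, ?_⟩
        exacts [Or.inr ⟨i, ⟨hi'.1, h3.1⟩, rfl⟩, Or.inr ⟨k, ⟨hk'.1, h3.2⟩, rfl⟩,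
          Or.inr ⟨i, ⟨h3.1, hi'.2⟩, rfl⟩, Or.inr ⟨k, ⟨h3.2, hk'.2⟩, rfl⟩]
    · rintro (⟨hxy, hx, hy⟩ | ⟨hxy, hx, hy⟩)
      · have hsub : brs v a j ∪ p '' Set.Icc a j ⊆ brs v a b ∪ p '' Set.Icc a b :=
          Set.union_subset_union (branches_mono le_rfl hjb.le)
            (Set.image_mono (Set.Icc_subset_Icc le_rfl hjb.le))
        exact ⟨hxy, hsub hx, hsub hy⟩
      · have hsub : brs v j b ∪ p '' Set.Icc j b ⊆ brs v a b ∪ p '' Set.Icc a b :=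
          Set.union_subset_union (branches_mono haj.le le_rfl)
            (Set.image_mono (Set.Icc_subset_Icc haj.le le_rfl))
        exact ⟨hxy, hsub hx, hsub hy⟩
  have hjN : j ≤ N := by omega
  refine ⟨?_, ?_, rfl, rfl, ?_, ?_, ?_, ?_, ?_, ?_, ?_⟩
  · exact Fin.forall_fin_two.2 ⟨rfl, rfl⟩
  · intro i
    obtain rfl : i = 0 := Fin.fin_one_eq_zero i
    rfl
  · refine hbr.trans ?_
    ext u
    simp [Fin.exists_fin_two, piece]
  · refine (congrArg (p '' ·) hIcc).trans ?_
    ext u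
    simp [Fin.exists_fin_two, piece, Set.image_union]
  · ext x y
    rw [hgraph, SimpleGraph.iSup_adj, Fin.exists_fin_two]
    rfl
  · refine Fin.forall_fin_two.2 ⟨Fin.forall_fin_two.2 ⟨fun h' => absurd rfl h', fun _ => hTT⟩,
      Fin.forall_fin_two.2 ⟨fun _ => (Set.inter_comm _ _).trans hTT, fun h' => absurd rfl h'⟩⟩
  · exact Fin.forall_fin_two.2 ⟨Fin.forall_fin_two.2 ⟨hTP _ _ _ _ hjN, hTP _ _ _ _ hb⟩,
      Fin.forall_fin_two.2 ⟨hTP _ _ _ _ hjN, hTP _ _ _ _ hb⟩⟩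
  · intro i
    obtain rfl : i = 0 := Fin.fin_one_eq_zero i
    exact hPP
  · intro i k hik
    omega

theorem nonempty_decomposition_of_children (h : IsNoncrossing G T ρ par dep p N)
    {v : V} (hv : v ∈ T)
    (ih : ∀ c ∈ T, c ≠ ρ → par c = v → ∀ a b, a < b → b ≤ N →
      Nonempty (SPQDecomposition (pc c a b))) :
    ∀ (m a b : ℕ), b - a = m → a < b → b ≤ N →
      Nonempty (SPQDecomposition (pc v a b)) := by
  intro m
  induction m using Nat.strong_induction_on with
  | _ m ihm =>
  intro a b hm hab hb
  by_cases hS : ∃ c, chi v a b c ∧ loc c = a ∧ hic c = b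
  · obtain ⟨c, hc, hlo, hhi⟩ := hS
    obtain ⟨t⟩ := ih c hc.1 hc.2.1 hc.2.2.1 a b hab hb
    exact ⟨.sNode _ _ (h.isSNode_piece hv hb hc.1 hc.2.1 hc.2.2.1 hlo hhi) t⟩
  by_cases hQ : b = a + 1
  · subst hQ
    refine ⟨.qNode _ (h.isQNode_piece hv hb fun c hc => hS ⟨c, hc, ?_⟩)⟩
    have h1 := h.lo_lt_hi hc.1 hc.2.1
    have h2 := hc.2.2.2
    omega
  -- Try `j = a + 1`. A child `c` straddling it starts at `a`, and it ends before `b` because it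
  -- does not span the piece. Then `j = hic c` works: a child straddling it would share with `c` the
  -- path edge ending at `hic c`.
  obtain ⟨j, haj, hjb, hj⟩ : ∃ j, a < j ∧ j < b ∧ ∀ c, chi v a b c → hic c ≤ j ∨ j ≤ loc c := by
    by_contra! hcon
    obtain ⟨c, hc, h1, h2⟩ := hcon (a + 1) (by omega) (by omega)
    have h3 := hc.2.2.2
    have hlo : loc c = a := by omega
    have hhi : hic c < b := lt_of_le_of_ne h3.2 fun h4 => hS ⟨c, hc, hlo, h4⟩
    obtain ⟨c', hc', h1', h2'⟩ := hcon (hic c) (by omega) hhi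
    obtain rfl : c = c' := h.child_unique (j := hic c - 1) ⟨hc.1, hc.2.1, hc.2.2.1⟩
      ⟨hc'.1, hc'.2.1, hc'.2.2.1⟩ (by omega) (by omega) (by omega) (by omega)
    omega
  obtain ⟨t1⟩ := ihm (j - a) (by omega) a j rfl haj (by omega)
  obtain ⟨t2⟩ := ihm (b - j) (by omega) j b rfl hjb hb
  exact ⟨.pNode _ 0 _ (h.isPNode_piece hv hb haj hjb hj)
    (Fin.cons t1 (Fin.cons t2 finZeroElim))⟩

theorem nonempty_decomposition_piece [Finite V] (h : IsNoncrossing G T ρ par dep p N) :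
    ∀ (m : ℕ) (v : V), (desc v).ncard = m → v ∈ T → ∀ a b, a < b → b ≤ N →
      Nonempty (SPQDecomposition (pc v a b)) := by
  intro m
  induction m using Nat.strong_induction_on with
  | _ m ihm =>
  intro v hm hv a b hab hb
  refine h.nonempty_decomposition_of_children hv ?_ (b - a) a b rfl hab hb
  intro c hcT hc hp a' b' hab' hb'
  refine ihm _ ?_ c rfl hcT a' b' hab' hb'
  rw [← hm]
  refine Set.ncard_lt_ncard ⟨IsParentFunction.descendants_subset hp, fun hsub => ?_⟩
  exact h.par_notMem_descendants hcT hc (hp.symm ▸ hsub (IsParentFunction.self_mem hv))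

theorem nonempty_decomposition [Finite V] (h : IsNoncrossing G T ρ par dep p N) (hN : 0 < N)
    {X : PathTreeData V} (hX : X.graph = G) (hT : X.treeVerts = T) (hρ : X.root = ρ)
    (hP : X.pathVerts = Tᶜ) (hP' : X.pathVerts = p '' Set.Icc 0 N)
    (hl : X.left = p 0) (hr : X.right = p N) : Nonempty (SPQDecomposition X) := by
  have hatt : ∀ i ∈ att ρ, 0 ≤ i ∧ i ≤ N := fun i hi => ⟨Nat.zero_le i, hi.1⟩
  obtain ⟨t⟩ := h.nonempty_decomposition_piece _ ρ rfl h.root_mem 0 N hN le_rfl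
  have hbr : brs ρ 0 N = T := (h.branches_eq h.root_mem hatt).trans h.descendants_root
  have huniv : ∀ x, x ∈ brs ρ 0 N ∪ p '' Set.Icc 0 N := by
    intro x
    rw [hbr, ← hP', hP]
    exact em _
  suffices hXe : X = pc ρ 0 N from ⟨hXe ▸ t⟩
  obtain ⟨tv, pv, gr, ro, le, ri⟩ := X
  simp only at hX hT hρ hP' hl hr
  subst hX hT hρ hP' hl hr
  simp only [piece, PathTreeData.mk.injEq, hbr, true_and, and_true]
  ext x y
  have hx := huniv x
  have hy := huniv y
  rw [hbr] at hx hy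
  exact ⟨fun hxy => ⟨hxy, hx, hy⟩, fun hxy => hxy.1⟩

end IsNoncrossing

/-! ### Existence of parent functions. -/

theorem SimpleGraph.IsTree.exists_parent {W : Type u} {T : SimpleGraph W} (hT : T.IsTree) (r : W) :
    ∃ (par : W → W) (dep : W → ℕ), par r = r ∧ (∀ v, v ≠ r → dep v = dep (par v) + 1) ∧
      ∀ u v, T.Adj u v ↔ (u ≠ r ∧ par u = v) ∨ (v ≠ r ∧ par v = u) := by
  choose P hP huniq using fun v => hT.existsUnique_path r v
  have hnil : P r = .nil := (huniq r _ SimpleGraph.Walk.IsPath.nil).symm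
  have hadj : ∀ v, v ≠ r → T.Adj (P v).penultimate v := fun v hv =>
    SimpleGraph.Walk.adj_penultimate (SimpleGraph.Walk.not_nil_of_ne hv.symm)
  have hpar : ∀ u v, T.Adj u v → v ∈ (P u).support → u ≠ r ∧ (P u).penultimate = v := by
    intro u v huv hv
    refine ⟨?_, (hT.isAcyclic.eq_penultimate_of_adj_end (hP u) huv hv).symm⟩
    rintro rfl
    rw [hnil] at hv
    simp only [SimpleGraph.Walk.support_nil, List.mem_singleton] at hv
    exact huv.ne hv.symm
  -- `P v` is the unique path from `r` to `v`. The penultimate vertex of the trivial walk is `r`,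
  -- which makes `r` a fixed point of the parent function.
  refine ⟨fun v => (P v).penultimate, fun v => (P v).length, by simp [hnil], ?_, ?_⟩
  · intro v hv
    have h1 : (P v).dropLast = P (P v).penultimate :=
      huniq _ _ ((hP v).dropLast)
    have h2 := congrArg SimpleGraph.Walk.length
      (SimpleGraph.Walk.concat_dropLast (p := P v) (hadj v hv))
    rw [SimpleGraph.Walk.length_concat, h1] at h2
    exact h2.symm
  · intro u v
    constructor
    · intro huv
      by_cases hv : v ∈ (P u).support
      · exact Or.inl (hpar u v huv hv)
      · exact Or.inr (hpar v u huv.symm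
          (hT.isAcyclic.mem_support_of_ne_mem_support_of_adj_of_isPath (hP v) (hP u) huv.symm hv))
    · rintro (⟨h1, rfl⟩ | ⟨h1, rfl⟩)
      · exact (hadj u h1).symm
      · exact hadj v h1

theorem SimpleGraph.IsTree.exists_isParentFunction {V : Type u} {G : SimpleGraph V} {T : Set V}
    (hT : (G.induce T).IsTree) {ρ : V} (hρ : ρ ∈ T) :
    ∃ (par : V → V) (dep : V → ℕ), IsParentFunction G T ρ par dep := by
  classical
  obtain ⟨par, dep, h1, h2, h3⟩ := hT.exists_parent ⟨ρ, hρ⟩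
  have hval : ∀ v (hv : v ∈ T), (if h : v ∈ T then (par ⟨v, h⟩ : V) else v) = par ⟨v, hv⟩ :=
    fun v hv => dif_pos hv
  have hdep : ∀ v (hv : v ∈ T), (if h : v ∈ T then dep ⟨v, h⟩ else 0) = dep ⟨v, hv⟩ :=
    fun v hv => dif_pos hv
  refine ⟨fun v => if h : v ∈ T then par ⟨v, h⟩ else v,
    fun v => if h : v ∈ T then dep ⟨v, h⟩ else 0, hρ, ?_, ?_, ?_, ?_⟩
  · rw [hval ρ hρ, h1]
  · intro v hv
    simp only [hval v hv]
    exact (par ⟨v, hv⟩).2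
  · intro v hv hne
    simp only [hval v hv, hdep v hv]
    rw [hdep _ (par ⟨v, hv⟩).2, h2 _ fun h => hne (congrArg Subtype.val h)]
  · intro u hu v hv
    have := h3 ⟨u, hu⟩ ⟨v, hv⟩
    simp only [SimpleGraph.induce_adj, ne_eq, Subtype.ext_iff] at this
    simp only [hval u hu, hval v hv]
    exact this

/-! ### Mod 2 homology of a plane embedding. -/

namespace EmbeddedMultigraph

variable {V : Type u} (H : EmbeddedMultigraph V)

noncomputable instance instFintypeDart : Fintype H.Dart := @Fintype.ofFinite _ H.finite_dart

instance instFiniteFace (S : Set H.Dart) : Finite (H.FaceAfterDeleting S) :=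
  @Quotient.finite _ _ (H.faceSetoid S)

theorem faceOf_rot_rev (S : Set H.Dart) (d : H.Dart) :
    H.faceOf S (H.rot (H.rev d)) = H.faceOf S d :=
  Quotient.sound (s := H.faceSetoid S) (Relation.EqvGen.symm _ _ (.rel _ _ (Or.inl rfl)))

theorem faceOf_rot (S : Set H.Dart) (d : H.Dart) :
    H.faceOf S (H.rot d) = H.faceOf S (H.rev d) := by
  rw [← H.faceOf_rot_rev S (H.rev d), H.rev_rev]

theorem src_rot (d : H.Dart) : H.src (H.rot d) = H.src d :=
  (H.sameCycle_rot _ _).1 (Equiv.Perm.sameCycle_apply_left.2 (Equiv.Perm.SameCycle.refl _ _))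

theorem tgt_rev (d : H.Dart) : H.tgt (H.rev d) = H.src d := by rw [tgt, H.rev_rev]

theorem rev_injective : Function.Injective H.rev :=
  (show Function.Involutive H.rev from H.rev_rev).injective

theorem exists_rot_pow_eq {d e : H.Dart} (h : H.src d = H.src e) :
    ∃ n : ℕ, (H.rot ^ n) d = e := by
  obtain ⟨n, -, hn⟩ := ((H.sameCycle_rot d e).2 h).exists_pow_eq'
  exact ⟨n, hn⟩

/-- The rotation is transitive on the darts at `v`. The target is `Sort*` so that `f` may also be a
predicate on darts. -/
theorem eq_of_src_eq {α : Sort*} (f : H.Dart → α) {v : V}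
    (hf : ∀ d, H.src d = v → f (H.rot d) = f d) {d e : H.Dart} (hd : H.src d = v)
    (he : H.src e = v) : f d = f e := by
  obtain ⟨n, rfl⟩ := H.exists_rot_pow_eq (hd.trans he.symm)
  clear he
  have : ∀ n : ℕ, H.src ((H.rot ^ n) d) = v ∧ f ((H.rot ^ n) d) = f d := by
    intro n
    induction n with
    | zero => exact ⟨hd, rfl⟩
    | succ n ih =>
      rw [pow_succ', Equiv.Perm.mul_apply]
      exact ⟨(H.src_rot _).trans ih.1, (hf _ ih.1).trans ih.2⟩
  exact (this n).2.symm

open Classical in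
/-- The mod 2 boundary of a chain of darts. -/
noncomputable def boundary : (H.Dart → ZMod 2) →ₗ[ZMod 2] (V → ZMod 2) where
  toFun g v := ∑ d, if H.src d = v then g d else 0
  map_add' g g' := by
    ext v
    simp only [Pi.add_apply, ← Finset.sum_add_distrib]
    exact Finset.sum_congr rfl fun d _ => by split_ifs <;> simp
  map_smul' a g := by
    ext v
    simp only [Pi.smul_apply, RingHom.id_apply, smul_eq_mul, Finset.mul_sum]
    exact Finset.sum_congr rfl fun d _ => by split_ifs <;> simp

open Classical in
theorem boundary_single (d : H.Dart) :
    H.boundary (Pi.single d 1) = Pi.single (H.src d) 1 := by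
  ext v
  simp only [boundary, LinearMap.coe_mk, AddHom.coe_mk, Pi.single_apply]
  rw [Finset.sum_eq_single d]
  · simp [eq_comm]
  · intro e _ he
    simp [he]
  · simp

/-- The symmetric functions on darts, i.e. the functions on edges. -/
def edgeFunctions : Submodule (ZMod 2) (H.Dart → ZMod 2) where
  carrier := {g | ∀ d, g (H.rev d) = g d}
  add_mem' hg hg' d := by simp only [Pi.add_apply, hg d, hg' d]
  zero_mem' _ := rfl
  smul_mem' a g hg d := by simp only [Pi.smul_apply, hg d]

open Classical in
/-- The indicator function of the edge of a dart. -/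
noncomputable def edgeIndicator (d : H.Dart) : H.Dart → ZMod 2 :=
  Pi.single d 1 + Pi.single (H.rev d) 1

theorem edgeIndicator_mem (d : H.Dart) : H.edgeIndicator d ∈ H.edgeFunctions := by
  classical
  intro e
  simp only [edgeIndicator, Pi.add_apply, Pi.single_apply]
  rw [add_comm]
  congr 1
  · exact if_congr (H.rev_injective.eq_iff) rfl rfl
  · refine if_congr ⟨?_, ?_⟩ rfl rfl
    · rintro rfl; exact (H.rev_rev e).symm
    · rintro rfl; exact H.rev_rev d

open Classical in
theorem boundary_edgeIndicator (d : H.Dart) :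
    H.boundary (H.edgeIndicator d) = Pi.single (H.src d) 1 + Pi.single (H.tgt d) 1 := by
  rw [edgeIndicator, map_add, boundary_single, boundary_single, tgt]

theorem two_mul_finrank_edgeFunctions_le :
    2 * Module.finrank (ZMod 2) H.edgeFunctions ≤ Nat.card H.Dart := by
  classical
  have := H.finite_dart
  let φ := Finite.equivFin H.Dart
  -- An enumeration of the darts selects exactly one dart of each edge.
  let P : H.Dart → Prop := fun d => φ d < φ (H.rev d)
  have hP : ∀ d, P (H.rev d) ↔ ¬ P d := by
    intro d
    have hne : φ d ≠ φ (H.rev d) := fun h => H.rev_ne d (φ.injective h).symm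
    simp only [P, H.rev_rev, not_lt]
    exact ⟨le_of_lt, fun h => lt_of_le_of_ne h hne.symm⟩
  have hcard : 2 * Nat.card {d // P d} = Nat.card H.Dart := by
    have h1 : Nat.card {d // P d} = Nat.card {d // ¬ P d} :=
      Nat.card_congr
        { toFun := fun d => ⟨H.rev d, fun h => (hP _).1 h d.2⟩
          invFun := fun d => ⟨H.rev d, (hP _).2 d.2⟩
          left_inv := fun d => Subtype.ext (H.rev_rev d)
          right_inv := fun d => Subtype.ext (H.rev_rev d) }
    rw [← Nat.card_congr (Equiv.sumCompl P), Nat.card_sum, ← h1, two_mul]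
  let L : H.edgeFunctions →ₗ[ZMod 2] ({d // P d} → ZMod 2) :=
    (LinearMap.funLeft (ZMod 2) (ZMod 2) Subtype.val).comp H.edgeFunctions.subtype
  have hL : Function.Injective L := by
    intro g g' h
    have h' : ∀ d, P d → g.1 d = g'.1 d := fun d hd => congrFun h ⟨d, hd⟩
    refine Subtype.ext (funext fun d => ?_)
    by_cases hd : P d
    · exact h' d hd
    · rw [← g.2 d, ← g'.2 d]
      exact h' _ ((hP d).2 hd)
  have h2 := LinearMap.finrank_le_finrank_of_injective hL
  rw [Module.finrank_fintype_fun_eq_card, ← Nat.card_eq_fintype_card] at h2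
  omega

/-- Modulo boundaries of edges, the indicators of adjacent vertices agree; by connectedness, all of
them agree with that of `v₀`. -/
theorem card_le_finrank_range_boundary [Finite V] (hconn : H.toSimple.Connected) :
    Nat.card V ≤ Module.finrank (ZMod 2) (H.boundary.domRestrict H.edgeFunctions).range + 1 := by
  classical
  have := Fintype.ofFinite V
  obtain ⟨v₀⟩ := hconn.nonempty
  set B := (H.boundary.domRestrict H.edgeFunctions).range with hB
  have hmem : ∀ v, (Pi.single v 1 : V → ZMod 2) ∈ B ⊔ Submodule.span (ZMod 2) {Pi.single v₀ 1} := by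
    intro v
    obtain ⟨w⟩ := hconn.preconnected v v₀
    induction w with
    | nil => exact Submodule.mem_sup_right (Submodule.mem_span_singleton_self _)
    | @cons a b _ hab _ ih =>
      obtain ⟨-, d, rfl, rfl⟩ := hab
      have h1 : H.boundary (H.edgeIndicator d) ∈ B :=
        ⟨⟨_, H.edgeIndicator_mem d⟩, rfl⟩
      have h2 := Submodule.sub_mem _ (Submodule.mem_sup_left h1) ih
      rwa [boundary_edgeIndicator, add_sub_cancel_right] at h2
  have htop : B ⊔ Submodule.span (ZMod 2) {Pi.single v₀ 1} = ⊤ := by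
    rw [eq_top_iff, ← (Pi.basisFun (ZMod 2) V).span_eq, Submodule.span_le]
    rintro _ ⟨v, rfl⟩
    rw [Pi.basisFun_apply]
    exact hmem v
  have h1 := Submodule.finrank_add_le_finrank_add_finrank B
    (Submodule.span (ZMod 2) {(Pi.single v₀ 1 : V → ZMod 2)})
  rw [htop, finrank_top, Module.finrank_fintype_fun_eq_card, ← Nat.card_eq_fintype_card] at h1
  have h2 := finrank_span_le_card (R := ZMod 2) ({(Pi.single v₀ 1 : V → ZMod 2)} : Set _)
  simp only [Set.toFinset_singleton, Finset.card_singleton] at h2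
  omega

/-- The mod 2 boundary of a chain of faces. -/
noncomputable def faceBoundary : (H.Face → ZMod 2) →ₗ[ZMod 2] H.edgeFunctions where
  toFun f := ⟨fun d => f (H.faceOf ∅ d) + f (H.faceOf ∅ (H.rev d)), fun d => by
    simp only [H.rev_rev]; exact add_comm _ _⟩
  map_add' f f' := by
    ext d
    simp only [Pi.add_apply, Submodule.coe_add]
    ring
  map_smul' a f := by
    ext d
    simp [mul_add]

/-- Each corner at `v` is counted twice: the face of `rev d` is that of `rot d`, and `rot` permutes
the darts at `v`. -/
theorem boundary_faceBoundary (f : H.Face → ZMod 2) : H.boundary (H.faceBoundary f) = 0 := by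
  classical
  ext v
  simp only [boundary, faceBoundary, LinearMap.coe_mk, AddHom.coe_mk, Pi.zero_apply]
  have h1 : ∀ d, (if H.src d = v then f (H.faceOf ∅ d) + f (H.faceOf ∅ (H.rev d)) else 0) =
      (if H.src d = v then f (H.faceOf ∅ d) else 0) +
        (if H.src (H.rot d) = v then f (H.faceOf ∅ (H.rot d)) else 0) := by
    intro d
    rw [H.src_rot, H.faceOf_rot]
    split_ifs <;> simp
  simp only [h1, Finset.sum_add_distrib]
  rw [Equiv.sum_comp H.rot (fun d => if H.src d = v then f (H.faceOf ∅ d) else 0)]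
  exact CharTwo.add_self_eq_zero _

/-- A face function in the kernel does not change across an edge, hence is constant around each
vertex, and constant overall by connectedness. -/
theorem finrank_ker_faceBoundary_le (hconn : H.toSimple.Connected) :
    Module.finrank (ZMod 2) H.faceBoundary.ker ≤ 1 := by
  classical
  have := Fintype.ofFinite H.Face
  have hle : H.faceBoundary.ker ≤ Submodule.span (ZMod 2) {(fun _ => 1 : H.Face → ZMod 2)} := by
    intro f hf
    have h0 : ∀ d, f (H.faceOf ∅ d) = f (H.faceOf ∅ (H.rev d)) := by
      intro d
      have := congrFun (congrArg Subtype.val (LinearMap.mem_ker.1 hf)) d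
      exact CharTwo.add_eq_zero.1 this
    have h1 : ∀ d e, H.src d = H.src e → f (H.faceOf ∅ d) = f (H.faceOf ∅ e) := by
      intro d e h
      exact H.eq_of_src_eq (fun d => f (H.faceOf ∅ d)) (fun d _ => by rw [H.faceOf_rot, h0 d]) h rfl
    have h2 : ∀ u v, H.toSimple.Reachable u v → ∀ d e, H.src d = u → H.src e = v →
        f (H.faceOf ∅ d) = f (H.faceOf ∅ e) := by
      rintro u v ⟨w⟩
      induction w with
      | nil => rintro d e rfl h; exact h1 d e h.symm
      | cons hab _ ih =>
        obtain ⟨-, a, rfl, rfl⟩ := hab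
        intro d e hd he
        rw [h1 d a hd, h0 a]
        exact ih _ e rfl he
    have h3 : ∀ F F', f F = f F' := by
      intro F F'
      induction F using Quotient.inductionOn with | _ d =>
      induction F' using Quotient.inductionOn with | _ e =>
      exact h2 _ _ (hconn.preconnected _ _) d e rfl rfl
    rw [Submodule.mem_span_singleton]
    by_cases hne : Nonempty H.Face
    · obtain ⟨F⟩ := hne
      exact ⟨f F, funext fun F' => by simp [h3 F F']⟩
    · exact ⟨0, funext fun F' => absurd ⟨F'⟩ hne⟩
  refine (Submodule.finrank_mono hle).trans ((finrank_span_le_card _).trans ?_)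
  simp

/-- A combinatorial Jordan curve theorem. With `|E|` the number of edges, cycles have dimension at
most `|E| - |V| + 1` and boundaries of face sets at least `|F| - 1`; Euler's formula equates these
numbers, so every cycle is a boundary. The function `f` 2-colours the faces, changing exactly across
`g`. -/
theorem exists_face_coloring [Finite V] (hplane : H.IsConnectedPlane) {g : H.Dart → ZMod 2}
    (hsymm : g ∈ H.edgeFunctions) (hg : H.boundary g = 0) :
    ∃ f : H.Face → ZMod 2, ∀ d, g d = f (H.faceOf ∅ d) + f (H.faceOf ∅ (H.rev d)) := by
  classical
  have := Fintype.ofFinite H.Face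
  obtain ⟨hconn, heuler⟩ := hplane
  have hle : H.faceBoundary.range ≤ (H.boundary.domRestrict H.edgeFunctions).ker := by
    rintro _ ⟨f, rfl⟩
    exact H.boundary_faceBoundary f
  have h1 := LinearMap.finrank_range_add_finrank_ker H.faceBoundary
  rw [Module.finrank_fintype_fun_eq_card, ← Nat.card_eq_fintype_card] at h1
  have h2 := H.finrank_ker_faceBoundary_le hconn
  have h3 := LinearMap.finrank_range_add_finrank_ker (H.boundary.domRestrict H.edgeFunctions)
  have h4 := H.two_mul_finrank_edgeFunctions_le
  have h5 := H.card_le_finrank_range_boundary hconn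
  have heq := Submodule.eq_of_le_of_finrank_le hle (by omega)
  have hmem : (⟨g, hsymm⟩ : H.edgeFunctions) ∈ (H.boundary.domRestrict H.edgeFunctions).ker := hg
  rw [← heq] at hmem
  obtain ⟨f, hf⟩ := hmem
  exact ⟨f, fun d => (congrFun (congrArg Subtype.val hf) d).symm⟩

end EmbeddedMultigraph

/-! ### The outer face of a 3-connected cycle-tree. -/

namespace EmbeddedMultigraph

variable {V : Type u} {H : EmbeddedMultigraph V}

/-- The permutation of the darts that walks along the faces. -/
def faceNext (H : EmbeddedMultigraph V) : Equiv.Perm H.Dart :=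
  (Function.Involutive.toPerm H.rev H.rev_rev).trans H.rot

theorem sameCycle_of_faceOf_eq {d e : H.Dart} (h : H.faceOf ∅ d = H.faceOf ∅ e) :
    H.faceNext.SameCycle d e := by
  have h' : Relation.EqvGen _ d e := Quotient.exact (s := H.faceSetoid ∅) h
  induction h' with
  | rel a b hab =>
    rcases hab with rfl | ⟨ha, -⟩
    · exact (Equiv.Perm.sameCycle_apply_right (f := H.faceNext)).2 (Equiv.Perm.SameCycle.refl _ _)
    · exact absurd ha (Set.notMem_empty _)
  | refl a => exact Equiv.Perm.SameCycle.refl _ _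
  | symm a b hab ih => exact (ih (Quotient.sound (s := H.faceSetoid ∅) hab)).symm
  | trans a b c hab hbc ih1 ih2 =>
    exact (ih1 (Quotient.sound (s := H.faceSetoid ∅) hab)).trans
      (ih2 (Quotient.sound (s := H.faceSetoid ∅) hbc))

theorem IsThreeConnected.exists_dart_leaving (h3 : H.IsThreeConnected) {s K : Set V}
    (hs : s.ncard ≤ 2) {x t : V} (hx : x ∈ K) (hxs : x ∉ s) (ht : t ∉ K) (hts : t ∉ s) :
    ∃ d, H.src d ∈ K ∧ H.tgt d ∉ K ∧ H.tgt d ∉ s := by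
  obtain ⟨w⟩ := h3 s hs ⟨x, hxs⟩ ⟨t, hts⟩
  have key : ∀ (a b : ↥sᶜ), (H.toSimple.induce sᶜ).Walk a b → (a : V) ∈ K → (b : V) ∉ K →
      ∃ d, H.src d ∈ K ∧ H.tgt d ∉ K ∧ H.tgt d ∉ s := by
    intro a b w
    induction w with
    | nil => exact fun h1 h2 => absurd h1 h2
    | @cons a c b hac _ ih =>
      intro ha hb
      by_cases hc : (c : V) ∈ K
      · exact ih hc hb
      · obtain ⟨-, d, h1, h2⟩ := hac
        exact ⟨d, h1.symm ▸ ha, h2.symm ▸ hc, h2.symm ▸ c.2⟩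
  exact key _ _ w hx ht

section OuterFace

variable {outer : H.Face}

theorem src_mem_outerLevel {d : H.Dart} (hd : H.faceOf ∅ d = outer) :
    H.src d ∈ H.outerLevel outer := ⟨d, rfl, hd⟩

theorem tgt_mem_outerLevel {d : H.Dart} (hd : H.faceOf ∅ d = outer) :
    H.tgt d ∈ H.outerLevel outer :=
  ⟨H.rot (H.rev d), H.src_rot _, (H.faceOf_rot_rev ∅ d).trans hd⟩

/-- Delete the outer neighbours of `v`, at most two by the degree condition. By 3-connectedness `v`
is still joined to the tree, so it has a further neighbour, which is not outer. -/
theorem exists_dart_to_tree (hc : H.IsCycleTree outer) (h3 : H.IsThreeConnected)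
    {v : V} (hv : v ∈ H.outerLevel outer) :
    ∃ d, H.src d = v ∧ H.tgt d ∉ H.outerLevel outer := by
  obtain ⟨t, ht⟩ := hc.tree.connected.nonempty
  have := H.finite_dart
  obtain ⟨d, h1, -, h2⟩ := h3.exists_dart_leaving (K := {v}) (t := t) (x := v)
    (s := H.tgt '' {d | H.src d = v ∧ H.tgt d ∈ H.outerLevel outer})
    ((Set.ncard_image_le (Set.toFinite _)).trans
      ((Nat.card_coe_set_eq _).symm.trans (hc.cycle_degree v hv)).le) rfl
    (by rintro ⟨d, ⟨h1, -⟩, h2⟩; exact hc.loopless d (h1.trans h2.symm))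
    (by rintro rfl; exact ht hv)
    (by rintro ⟨d, ⟨-, h1⟩, rfl⟩; exact ht h1)
  exact ⟨d, h1, fun h4 => h2 ⟨d, ⟨h1, h4⟩, rfl⟩⟩

theorem rot_ne_self (hc : H.IsCycleTree outer) (h3 : H.IsThreeConnected)
    {d : H.Dart} (hd : H.src d ∈ H.outerLevel outer) : H.rot d ≠ d := by
  intro heq
  have hall : ∀ e, H.src e = H.src d → e = d := by
    intro e he
    have := H.eq_of_src_eq (fun x => x = d)
      (fun x _ => propext ⟨fun h => H.rot.injective (h.trans heq.symm),
        fun h => (congrArg H.rot h).trans heq⟩) he rfl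
    exact this.mpr rfl
  obtain ⟨e, he, heo⟩ := exists_dart_to_tree hc h3 hd
  obtain ⟨e', he', heo'⟩ := hd
  have h1 := tgt_mem_outerLevel heo'
  rw [hall e' he', ← hall e he] at h1
  exact heo h1

theorem tgt_rot_symm_mem {d : H.Dart} (hd : H.faceOf ∅ d = outer) :
    H.tgt (H.rot.symm d) ∈ H.outerLevel outer := by
  refine ⟨H.rev (H.rot.symm d), rfl, ?_⟩
  rw [← H.faceOf_rot, Equiv.apply_symm_apply, hd]

theorem src_rot_symm (d : H.Dart) : H.src (H.rot.symm d) = H.src d := by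
  rw [← H.src_rot, Equiv.apply_symm_apply]

/-- The dart `d` and its predecessor in the rotation both lead to outer vertices and are distinct;
degree two leaves room for no other. -/
theorem eq_or_eq_rot_symm (hc : H.IsCycleTree outer) (h3 : H.IsThreeConnected)
    {d d' : H.Dart} (hd : H.faceOf ∅ d = outer) (hs : H.src d' = H.src d)
    (ht : H.tgt d' ∈ H.outerLevel outer) : d' = d ∨ d' = H.rot.symm d := by
  have := H.finite_dart
  have hv := src_mem_outerLevel hd
  have hne : d ≠ H.rot.symm d := fun h => rot_ne_self hc h3 hv (H.rot.symm_apply_eq.1 h.symm).symm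
  have hsub : ({d, H.rot.symm d} : Set H.Dart) ⊆
      {e | H.src e = H.src d ∧ H.tgt e ∈ H.outerLevel outer} := by
    rintro e (rfl | rfl)
    · exact ⟨rfl, tgt_mem_outerLevel hd⟩
    · exact ⟨src_rot_symm d, tgt_rot_symm_mem hd⟩
  have heq := Set.eq_of_subset_of_ncard_le hsub (by
    rw [Set.ncard_pair hne]
    exact ((Nat.card_coe_set_eq _).symm.trans (hc.cycle_degree _ hv)).le) (Set.toFinite _)
  have hmem : d' ∈ {e | H.src e = H.src d ∧ H.tgt e ∈ H.outerLevel outer} := ⟨hs, ht⟩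
  rw [← heq] at hmem
  exact hmem

theorem rot_rot_ne_self (hc : H.IsCycleTree outer) (h3 : H.IsThreeConnected)
    {d : H.Dart} (hd : H.faceOf ∅ d = outer) : H.rot (H.rot d) ≠ d := by
  intro heq
  obtain ⟨e, he, heo⟩ := exists_dart_to_tree hc h3 (src_mem_outerLevel hd)
  have hsym : H.rot.symm d = H.rot d := H.rot.symm_apply_eq.2 heq.symm
  have hall := H.eq_of_src_eq (fun x => x = d ∨ x = H.rot d) (fun x _ => propext ⟨?_, ?_⟩) he rfl
  · rcases hall.mpr (Or.inl rfl) with rfl | rfl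
    · exact heo (tgt_mem_outerLevel hd)
    · exact heo (hsym ▸ tgt_rot_symm_mem hd)
  · rintro (h | h)
    · exact Or.inr (H.rot.injective (h.trans heq.symm))
    · exact Or.inl (H.rot.injective h)
  · rintro (rfl | rfl)
    · exact Or.inr rfl
    · exact Or.inl heq

/-- The outer face visits each vertex once: two outer corners at a vertex would be each other's
predecessors, leaving no room in the rotation for the dart into the tree. -/
theorem eq_of_faceOf_eq_outer (hc : H.IsCycleTree outer) (h3 : H.IsThreeConnected)
    {d d' : H.Dart} (hd : H.faceOf ∅ d = outer)
    (hd' : H.faceOf ∅ d' = outer) (hs : H.src d = H.src d') : d = d' := by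
  rcases eq_or_eq_rot_symm hc h3 hd hs.symm (tgt_mem_outerLevel hd') with h | h
  · exact h.symm
  rcases eq_or_eq_rot_symm hc h3 hd' hs (tgt_mem_outerLevel hd) with h' | h'
  · exact h'
  · refine absurd ?_ (rot_rot_ne_self hc h3 hd)
    rw [H.rot.eq_symm_apply.1 h', H.rot.eq_symm_apply.1 h]

theorem faceOf_rev_ne_outer (hc : H.IsCycleTree outer) (h3 : H.IsThreeConnected)
    {d : H.Dart} (hd : H.faceOf ∅ d = outer) :
    H.faceOf ∅ (H.rev d) ≠ outer := by
  intro h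
  have h1 := eq_of_faceOf_eq_outer hc h3 ((H.faceOf_rot_rev ∅ d).trans hd) h (H.src_rot _)
  exact rot_ne_self hc h3 (src_mem_outerLevel h) h1

/-- This places a tree vertex on the inner face at the outer edge of `d`, which serves as the common
witness when two subtrees cover the same path edge. -/
theorem tgt_rot_notMem (hc : H.IsCycleTree outer) (h3 : H.IsThreeConnected)
    {d : H.Dart} (hd : H.faceOf ∅ d = outer) :
    H.tgt (H.rot d) ∉ H.outerLevel outer := by
  intro ht
  rcases eq_or_eq_rot_symm hc h3 hd (H.src_rot d) ht with h | h
  · exact rot_ne_self hc h3 (src_mem_outerLevel hd) h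
  · exact rot_rot_ne_self hc h3 hd (by rw [h, Equiv.apply_symm_apply])

theorem faceOf_eq_outer_or_rev (hc : H.IsCycleTree outer) (h3 : H.IsThreeConnected)
    {d : H.Dart} (hs : H.src d ∈ H.outerLevel outer)
    (ht : H.tgt d ∈ H.outerLevel outer) :
    H.faceOf ∅ d = outer ∨ H.faceOf ∅ (H.rev d) = outer := by
  obtain ⟨e, he, heo⟩ := hs
  rcases eq_or_eq_rot_symm hc h3 heo he.symm ht with rfl | rfl
  · exact Or.inl heo
  · right
    rw [← H.faceOf_rot, Equiv.apply_symm_apply, heo]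

end OuterFace

/-- The darts `o 0, …, o N` of the outer face in their circular order. -/
structure IsOuterWalk (H : EmbeddedMultigraph V) (outer : H.Face) (N : ℕ) (o : ℕ → H.Dart) :
    Prop where
  face : ∀ j, H.faceOf ∅ (o j) = outer
  next : ∀ j, H.rot (H.rev (o j)) = o (j + 1)
  period : o (N + 1) = o 0
  src_inj : ∀ i ≤ N, ∀ j ≤ N, H.src (o i) = H.src (o j) → i = j
  exists_src : ∀ v ∈ H.outerLevel outer, ∃ j ≤ N, H.src (o j) = v

theorem exists_isOuterWalk {outer : H.Face} (hc : H.IsCycleTree outer) (h3 : H.IsThreeConnected)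
    {ε : H.Dart} (hε : H.faceOf ∅ ε = outer) :
    ∃ (N : ℕ) (o : ℕ → H.Dart), H.IsOuterWalk outer N o ∧ o N = ε := by
  have := H.finite_dart
  have hpos : 0 < Function.minimalPeriod H.faceNext ε :=
    Function.minimalPeriod_pos_of_mem_periodicPts
      (Function.Injective.mem_periodicPts H.faceNext.injective ε)
  obtain ⟨N, hN⟩ : ∃ N, Function.minimalPeriod H.faceNext ε = N + 1 :=
    ⟨_, (Nat.succ_pred_eq_of_pos hpos).symm⟩
  have hper : H.faceNext^[N + 1] ε = ε := hN ▸ Function.iterate_minimalPeriod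
  have hface : ∀ j, H.faceOf ∅ (H.faceNext^[j] ε) = outer := by
    intro j
    induction j with
    | zero => exact hε
    | succ j ih =>
      rw [Function.iterate_succ_apply']
      exact (H.faceOf_rot_rev ∅ _).trans ih
  -- The shift by one makes `ε` the last dart of the walk, so that the edge to be removed closes the
  -- path.
  refine ⟨N, fun j => H.faceNext^[j + 1] ε, ⟨fun j => hface _, fun j => ?_, ?_, ?_, ?_⟩, hper⟩
  · rw [Function.iterate_succ_apply' _ (j + 1)]
    rfl
  · rw [Function.iterate_succ_apply', hper]
    rfl
  · intro i hi j hj hij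
    have h1 := eq_of_faceOf_eq_outer hc h3 (hface _) (hface _) hij
    rw [Function.iterate_succ_apply', Function.iterate_succ_apply'] at h1
    exact Function.iterate_injOn_Iio_minimalPeriod (f := H.faceNext) (x := ε)
      (by simp only [hN, Set.mem_Iio]; omega) (by simp only [hN, Set.mem_Iio]; omega)
      (H.faceNext.injective h1)
  · rintro v ⟨d, rfl, hd⟩
    have h1 : H.faceNext.SameCycle ε (H.faceNext.symm d) := by
      rw [← Equiv.Perm.sameCycle_apply_right, Equiv.apply_symm_apply]
      exact sameCycle_of_faceOf_eq (hε.trans hd.symm)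
    obtain ⟨m, -, hm⟩ := h1.exists_pow_eq'
    refine ⟨m % (N + 1), Nat.lt_succ_iff.1 (Nat.mod_lt _ N.succ_pos), congrArg H.src ?_⟩
    rw [Function.iterate_succ_apply', ← hN, Function.iterate_mod_minimalPeriod_eq,
      ← Equiv.Perm.coe_pow, hm, Equiv.apply_symm_apply]

end EmbeddedMultigraph

/-! ### Separation by a connected set of inner vertices. -/

namespace EmbeddedMultigraph

variable {V : Type u} {H : EmbeddedMultigraph V} {outer : H.Face}

namespace IsOuterWalk

variable {N : ℕ} {o : ℕ → H.Dart}

theorem tgt_eq (hw : H.IsOuterWalk outer N o) (j : ℕ) : H.tgt (o j) = H.src (o (j + 1)) := by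
  rw [← hw.next, src_rot, tgt]

theorem src_mem (hw : H.IsOuterWalk outer N o) (j : ℕ) : H.src (o j) ∈ H.outerLevel outer :=
  src_mem_outerLevel (hw.face j)

theorem eq_or_eq_rev (hw : H.IsOuterWalk outer N o) (hc : H.IsCycleTree outer)
    (h3 : H.IsThreeConnected) {j : ℕ} {d : H.Dart} (hs : H.src d = H.src (o (j + 1)))
    (ht : H.tgt d ∈ H.outerLevel outer) : d = o (j + 1) ∨ d = H.rev (o j) := by
  refine (eq_or_eq_rot_symm hc h3 (hw.face _) hs ht).imp id fun h => ?_
  rw [h, Equiv.symm_apply_eq, hw.next]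

theorem rev_ne (hw : H.IsOuterWalk outer N o) (hc : H.IsCycleTree outer)
    (h3 : H.IsThreeConnected) (i j : ℕ) : H.rev (o i) ≠ o j := fun h =>
  faceOf_rev_ne_outer hc h3 (hw.face i) (h ▸ hw.face j)

/-- The edges of the outer walk join consecutive vertices. -/
theorem exists_dart_iff (hw : H.IsOuterWalk outer N o) (hc : H.IsCycleTree outer)
    (h3 : H.IsThreeConnected) {i j : ℕ} (hi : i ≤ N) (hj : j ≤ N) {d : H.Dart}
    (hs : H.src d = H.src (o i)) (ht : H.tgt d = H.src (o j)) (h1 : d ≠ o N)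
    (h2 : d ≠ H.rev (o N)) :
    (d = o i ∧ i + 1 = j) ∨ (d = H.rev (o j) ∧ j + 1 = i) := by
  have hO : H.tgt d ∈ H.outerLevel outer := ht ▸ hw.src_mem j
  have hd : d = o i ∨ ∃ k < N, d = H.rev (o k) ∧ k + 1 = i := by
    -- For `i = 0` the vertex is also the source of `o (N + 1)`, whose other outer dart is the
    -- excluded `rev (o N)`.
    cases i with
    | zero =>
      rw [← hw.period] at hs
      rcases hw.eq_or_eq_rev hc h3 hs hO with h | h
      · exact Or.inl (h.trans hw.period)
      · exact absurd h h2
    | succ k =>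
      exact (hw.eq_or_eq_rev hc h3 hs hO).imp id fun h => ⟨k, hi, h, rfl⟩
  rcases hd with rfl | ⟨k, hk, rfl, hki⟩
  · have hiN : i ≠ N := fun h => h1 (h ▸ rfl)
    rw [hw.tgt_eq] at ht
    exact Or.inl ⟨rfl, hw.src_inj _ (by omega) _ hj ht⟩
  · rw [tgt_rev] at ht
    have := hw.src_inj _ (by omega) _ hj ht
    subst this
    exact Or.inr ⟨rfl, hki⟩

end IsOuterWalk

open Classical in
/-- In the mod 2 chains, `u` and `w` are joined by a walk inside `D`. -/
def IsLinked (H : EmbeddedMultigraph V) (D : Set V) (u w : V) : Prop :=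
  ∃ g ∈ H.edgeFunctions, (∀ d, g d ≠ 0 → H.src d ∈ D) ∧
    H.boundary g = Pi.single u 1 + Pi.single w 1

theorem IsLinked.refl (D : Set V) (u : V) : H.IsLinked D u u :=
  ⟨0, Submodule.zero_mem _, fun d h => absurd rfl h, by
    rw [map_zero]
    exact funext fun v => (CharTwo.add_self_eq_zero _).symm⟩

theorem IsLinked.trans {D : Set V} {u v w : V} (h : H.IsLinked D u v) (h' : H.IsLinked D v w) :
    H.IsLinked D u w := by
  obtain ⟨g, hg, hgD, hgb⟩ := h
  obtain ⟨g', hg', hgD', hgb'⟩ := h'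
  refine ⟨g + g', Submodule.add_mem _ hg hg', fun d hd => ?_, ?_⟩
  · by_contra hcon
    refine hd ?_
    rw [Pi.add_apply, not_not.1 fun h => hcon (hgD d h), not_not.1 fun h => hcon (hgD' d h),
      add_zero]
  · rw [map_add, hgb, hgb']
    funext x
    simp only [Pi.add_apply]
    rw [add_assoc, CharTwo.add_cancel_left]

theorem IsLinked.symm {D : Set V} {u w : V} (h : H.IsLinked D u w) : H.IsLinked D w u := by
  obtain ⟨g, hg, hgD, hgb⟩ := h
  exact ⟨g, hg, hgD, hgb.trans (add_comm _ _)⟩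

theorem edgeIndicator_eq_zero {d e : H.Dart} (h1 : d ≠ e) (h2 : d ≠ H.rev e) :
    H.edgeIndicator e d = 0 := by
  simp [edgeIndicator, h1, h2]

theorem edgeIndicator_self (d : H.Dart) : H.edgeIndicator d d = 1 := by
  simp [edgeIndicator, (H.rev_ne d).symm]

theorem IsLinked.of_dart {D : Set V} {d : H.Dart} (hs : H.src d ∈ D) (ht : H.tgt d ∈ D) :
    H.IsLinked D (H.src d) (H.tgt d) := by
  refine ⟨H.edgeIndicator d, H.edgeIndicator_mem d, fun e he => ?_, H.boundary_edgeIndicator d⟩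
  by_contra hcon
  refine he (edgeIndicator_eq_zero ?_ ?_)
  · rintro rfl; exact hcon hs
  · rintro rfl; exact hcon ht

/-- A connected set `D` of inner vertices attached to the outer vertices number `a` and `b` cuts off
everything between them from the inner vertices outside `D`. -/
theorem IsOuterWalk.separation [Finite V] {N : ℕ} {o : ℕ → H.Dart}
    (hw : H.IsOuterWalk outer N o) (hc : H.IsCycleTree outer) (h3 : H.IsThreeConnected)
    {D : Set V} (hD : ∀ v ∈ D, v ∉ H.outerLevel outer)
    (hlink : ∀ u ∈ D, ∀ w ∈ D, H.IsLinked D u w) {a b : ℕ} (hab : a < b) (hb : b ≤ N)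
    {da db : H.Dart} (hda : H.src da = H.src (o a)) (hda' : H.tgt da ∈ D)
    (hdb : H.src db = H.src (o b)) (hdb' : H.tgt db ∈ D) {ρ : V}
    (hρ : ρ ∉ H.outerLevel outer) (hρD : ρ ∉ D) {dρ : H.Dart} (hdρ : H.src dρ = ρ)
    (hface : H.faceOf ∅ dρ = H.faceOf ∅ (H.rev (o N)))
    (hout : ∀ u, u ∉ D → u ∉ H.outerLevel outer → Relation.ReflTransGen
      (fun x y => y ∉ D ∧ y ∉ H.outerLevel outer ∧ ∃ d, H.src d = x ∧ H.tgt d = y) ρ u) :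
    (∀ j, a < j → j < b → ∀ d, H.src d = H.src (o j) → H.tgt d ∉ H.outerLevel outer →
      H.tgt d ∈ D) ∧
    (∀ j, a ≤ j → j < b → ∀ d, H.src d ∉ H.outerLevel outer →
      H.faceOf ∅ d = H.faceOf ∅ (H.rev (o j)) → H.src d ∈ D) := by
  classical
  obtain ⟨g₁, hg₁, hg₁D, hg₁b⟩ := hlink _ hda' _ hdb'
  set g₂ : H.Dart → ZMod 2 := ∑ j ∈ Finset.Ico a b, H.edgeIndicator (o j) with hg₂
  -- The closed chain: through `D` from `da` to `db`, and back along the outer edges number `a, …, b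
  -- - 1`.
  set g : H.Dart → ZMod 2 := g₁ + H.edgeIndicator da + H.edgeIndicator db + g₂ with hg
  have hgs : g ∈ H.edgeFunctions :=
    Submodule.add_mem _ (Submodule.add_mem _ (Submodule.add_mem _ hg₁ (H.edgeIndicator_mem _))
      (H.edgeIndicator_mem _)) (Submodule.sum_mem _ fun _ _ => H.edgeIndicator_mem _)
  have hg₂b : ∀ n, a ≤ n → H.boundary (∑ j ∈ Finset.Ico a n, H.edgeIndicator (o j)) =
      Pi.single (H.src (o a)) 1 + Pi.single (H.src (o n)) 1 := by
    intro n hn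
    induction n, hn using Nat.le_induction with
    | base =>
      rw [Finset.Ico_self, Finset.sum_empty, map_zero]
      exact funext fun v => (CharTwo.add_self_eq_zero _).symm
    | succ n hn ih =>
      rw [Finset.sum_Ico_succ_top hn, map_add, ih, boundary_edgeIndicator, hw.tgt_eq, add_assoc]
      funext v
      simp only [Pi.add_apply]
      rw [CharTwo.add_cancel_left]
  have hgb : H.boundary g = 0 := by
    rw [hg, map_add, map_add, map_add, hg₁b, hg₂, hg₂b b hab.le, boundary_edgeIndicator,
      boundary_edgeIndicator, hda, hdb]
    funext v
    simp only [Pi.add_apply, Pi.zero_apply]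
    generalize (Pi.single (H.tgt da) 1 : V → ZMod 2) v = x₁
    generalize (Pi.single (H.tgt db) 1 : V → ZMod 2) v = x₂
    generalize (Pi.single (H.src (o a)) 1 : V → ZMod 2) v = x₃
    generalize (Pi.single (H.src (o b)) 1 : V → ZMod 2) v = x₄
    revert x₁ x₂ x₃ x₄
    decide
  have hOD : ∀ {v}, v ∈ H.outerLevel outer → v ∉ D := fun hv hvD => hD _ hvD hv
  have hg₁0 : ∀ d, H.src d ∉ D → g₁ d = 0 := fun d hd => not_not.1 fun h => hd (hg₁D d h)
  have hrest : ∀ d, H.src d ∉ D → d ≠ da → d ≠ db → g d = g₂ d := by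
    intro d hd h1 h2
    rw [hg, Pi.add_apply, Pi.add_apply, Pi.add_apply, hg₁0 d hd,
      edgeIndicator_eq_zero h1 (by rintro rfl; exact hd hda'),
      edgeIndicator_eq_zero h2 (by rintro rfl; exact hd hdb'), add_zero, add_zero, zero_add]
  have hg₂0 : ∀ d, (∀ j, a ≤ j → j < b → d ≠ o j ∧ d ≠ H.rev (o j)) → g₂ d = 0 := by
    intro d hd
    rw [hg₂, Finset.sum_apply]
    refine Finset.sum_eq_zero fun j hj => ?_
    have hj' := Finset.mem_Ico.1 hj
    exact edgeIndicator_eq_zero (hd j hj'.1 hj'.2).1 (hd j hj'.1 hj'.2).2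
  have ho : ∀ j d, H.tgt d ∈ D → o j ≠ d := by
    rintro j _ h rfl
    rw [hw.tgt_eq] at h
    exact hOD (hw.src_mem _) h
  have hg₂1 : ∀ j, a ≤ j → j < b → g (o j) = 1 := by
    intro j h1 h2
    rw [hrest _ (hOD (hw.src_mem j)) (ho j da hda') (ho j db hdb'), hg₂, Finset.sum_apply,
      Finset.sum_eq_single_of_mem j (Finset.mem_Ico.2 ⟨h1, h2⟩), edgeIndicator_self]
    intro i hi hij
    have hi' := Finset.mem_Ico.1 hi
    refine edgeIndicator_eq_zero ?_ (hw.rev_ne hc h3 i j).symm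
    intro h
    exact hij (hw.src_inj i (by omega) j (by omega) (congrArg H.src h.symm))
  obtain ⟨f, hf⟩ := H.exists_face_coloring hc.plane hgs hgb
  have hrev : ∀ d, f (H.faceOf ∅ (H.rev d)) = f (H.faceOf ∅ d) + g d := fun d => by
    rw [hf, CharTwo.add_cancel_left]
  have hrot : ∀ d, f (H.faceOf ∅ (H.rot d)) = f (H.faceOf ∅ d) + g d := fun d => by
    rw [H.faceOf_rot, hrev]
  have htree : ∀ u, u ∉ D → u ∉ H.outerLevel outer → ∀ d, H.src d = u → g d = 0 := by
    rintro u hu huO d rfl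
    rw [hrest d hu, hg₂0]
    · intro j _ _
      refine ⟨?_, ?_⟩
      · rintro rfl; exact huO (hw.src_mem j)
      · rintro rfl
        exact huO (tgt_mem_outerLevel (hw.face j))
    · rintro rfl; exact huO (hda ▸ hw.src_mem a)
    · rintro rfl; exact huO (hdb ▸ hw.src_mem b)
  have hconst : ∀ u, u ∉ D → u ∉ H.outerLevel outer → ∀ d e, H.src d = u → H.src e = u →
      f (H.faceOf ∅ d) = f (H.faceOf ∅ e) := by
    intro u hu huO d e hd he
    refine H.eq_of_src_eq (fun d => f (H.faceOf ∅ d)) (v := u) (fun d hd => ?_) hd he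
    rw [hrot, htree u hu huO d hd, add_zero]
  -- Since `b ≤ N`, the edge of `o N` is not in the chain, so its two sides have the same colour.
  have hεN : f (H.faceOf ∅ (H.rev (o N))) = f outer := by
    rw [hrev, hw.face, hrest _ (hOD (hw.src_mem N)) (ho N da hda') (ho N db hdb'), hg₂0, add_zero]
    intro j h1 h2
    refine ⟨fun h => ?_, (hw.rev_ne hc h3 j N).symm⟩
    have := hw.src_inj N le_rfl j (by omega) (congrArg H.src h)
    omega
  -- The chain avoids inner vertices outside `D`, so the outer colour spreads from `ρ` to all of
  -- them; below the arc from `a` to `b` the inner faces have the opposite colour (`hB`).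
  have hA : ∀ u, u ∉ D → u ∉ H.outerLevel outer → ∀ d, H.src d = u →
      f (H.faceOf ∅ d) = f outer := by
    intro u hu huO
    have hwalk := hout u hu huO
    clear hu huO
    induction hwalk with
    | refl =>
      intro d hd
      rw [hconst ρ hρD hρ d dρ hd hdρ, hface, hεN]
    | @tail x y hx hxy ih =>
      obtain ⟨hy, hyO, e, rfl, rfl⟩ := hxy
      intro d hd
      rw [hconst _ hy hyO d (H.rot (H.rev e)) hd (H.src_rot _), H.faceOf_rot_rev, ih e rfl]
  have hB : ∀ j, a ≤ j → j < b → f (H.faceOf ∅ (H.rev (o j))) = f outer + 1 := by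
    intro j h1 h2
    rw [hrev, hw.face, hg₂1 j h1 h2]
  have hne : f outer + 1 ≠ f outer := by
    generalize f outer = x
    revert x
    decide
  constructor
  · intro j haj hjb d hd hdO
    by_contra hdD
    obtain ⟨k, rfl⟩ : ∃ k, j = k + 1 := ⟨j - 1, by omega⟩
    -- Strictly between `a` and `b`, the only darts of the chain at this vertex are `o (k + 1)` and
    -- `rev (o k)`. Rotating past the first flips the colour to the inner one, which persists until
    -- the second is passed and the rotation is back at `o (k + 1)`.
    have hall : ∀ n : ℕ, H.src ((H.rot ^ n) (o (k + 1))) = H.src (o (k + 1)) ∧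
        ((H.rot ^ n) (o (k + 1)) = o (k + 1) ∨
          f (H.faceOf ∅ ((H.rot ^ n) (o (k + 1)))) = f outer + 1) := by
      intro n
      induction n with
      | zero => exact ⟨rfl, Or.inl rfl⟩
      | succ n ih =>
        rw [pow_succ', Equiv.Perm.mul_apply]
        set x := (H.rot ^ n) (o (k + 1)) with hx
        refine ⟨(H.src_rot x).trans ih.1, ?_⟩
        by_cases h1 : x = o (k + 1)
        · right
          rw [h1, hrot, hw.face, hg₂1 _ haj.le hjb]
        have h2 := ih.2.resolve_left h1
        by_cases h4 : x = H.rev (o k)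
        · left
          rw [h4, hw.next]
        right
        rw [hrot, h2, hrest x (ih.1 ▸ hOD (hw.src_mem _)), hg₂0, add_zero]
        · intro i hia hib
          refine ⟨fun h => ?_, fun h => ?_⟩
          · have := hw.src_inj _ (by omega) i (by omega) (ih.1.symm.trans (congrArg H.src h))
            subst this
            exact h1 h
          · have h5 := ih.1.symm.trans (congrArg H.src h)
            change _ = H.tgt (o i) at h5
            rw [hw.tgt_eq] at h5
            have := hw.src_inj _ (by omega) _ (by omega) h5
            obtain rfl : k = i := by omega
            exact h4 h
        · intro h
          have := hw.src_inj _ (by omega) _ (by omega)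
            (ih.1.symm.trans ((congrArg H.src h).trans hda))
          omega
        · intro h
          have := hw.src_inj _ (by omega) _ (by omega)
            (ih.1.symm.trans ((congrArg H.src h).trans hdb))
          omega
    obtain ⟨n, hn⟩ := H.exists_rot_pow_eq hd.symm
    have h1 := (hall n).2
    rw [hn] at h1
    rcases h1 with h1 | h1
    · rw [h1, hw.tgt_eq] at hdO
      exact hdO (hw.src_mem _)
    · rw [← H.faceOf_rot_rev ∅ d, hA _ hdD hdO (H.rot (H.rev d)) (H.src_rot _)] at h1
      exact hne h1.symm
  · intro j haj hjb d hdO hdf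
    by_contra hdD
    have h1 := hA _ hdD hdO d rfl
    rw [hdf, hB j haj hjb] at h1
    exact hne h1

/-- If all edges of `S` other than that of `ε` have an end vertex `ρ`, and `ρ` and `ε` share a face
after deleting `S`, then `ρ` is incident to the inner face at `ε`. -/
theorem exists_dart_inner_face {S : Set H.Dart} {ε e dρ : H.Dart}
    (hε : H.faceOf ∅ ε = outer) (heε : e = ε ∨ e = H.rev ε)
    (hρ : H.src dρ ∉ H.outerLevel outer)
    (hS : ∀ d ∈ S, d = e ∨ d = H.rev e ∨ H.src d = H.src dρ ∨ H.tgt d = H.src dρ)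
    (hF : H.faceOf S dρ = H.faceOf S e) :
    ∃ d, H.src d = H.src dρ ∧ H.faceOf ∅ d = H.faceOf ∅ (H.rev ε) := by
  by_contra! hcon
  -- `M` is the union of the two faces at `ε`. If `ρ` met neither of them, deleting `S` would merge
  -- no further face into `M`, because every other edge of `S` has `ρ` as an end; then `ρ` could not
  -- share a face with `e`.
  let M : H.Dart → Prop := fun d => H.faceOf ∅ d = outer ∨ H.faceOf ∅ d = H.faceOf ∅ (H.rev ε)
  have hM : ∀ d, M d → H.src d ≠ H.src dρ := by
    rintro d (hd | hd) hs
    · exact hρ (hs ▸ src_mem_outerLevel hd)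
    · exact hcon d hs hd
  have hMnext : ∀ d, M (H.rot (H.rev d)) ↔ M d := fun d => by
    simp only [M, H.faceOf_rot_rev]
  have hMtgt : ∀ d, M d → H.tgt d ≠ H.src dρ := by
    intro d hd
    have := hM _ ((hMnext d).2 hd)
    rwa [H.src_rot] at this
  have h1 : M ε := Or.inl hε
  have h2 : M (H.rev ε) := Or.inr rfl
  have he : M e ∧ M (H.rev e) := by
    rcases heε with rfl | rfl
    · exact ⟨h1, h2⟩
    · rw [H.rev_rev]; exact ⟨h2, h1⟩
  have hMS : ∀ d ∈ S, M d ↔ M (H.rev d) := by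
    intro d hd
    rcases hS d hd with rfl | rfl | h | h
    · exact iff_of_true he.1 he.2
    · rw [H.rev_rev]; exact iff_of_true he.2 he.1
    · exact iff_of_false (fun h' => hM d h' h)
        (fun h' => hMtgt _ h' ((H.tgt_rev d).trans h))
    · exact iff_of_false (fun h' => hMtgt d h' h) (fun h' => hM _ h' h)
  have hgen : ∀ x y, Relation.EqvGen
      (fun a b => b = H.rot (H.rev a) ∨ (a ∈ S ∧ b = H.rev a)) x y → (M x ↔ M y) := by
    intro x y hxy
    induction hxy with
    | rel a b hab =>
      rcases hab with rfl | ⟨ha, rfl⟩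
      · exact (hMnext a).symm
      · exact hMS a ha
    | refl a => exact Iff.rfl
    | symm a b _ ih => exact ih.symm
    | trans a b c _ _ ih1 ih2 => exact ih1.trans ih2
  exact hM dρ ((hgen _ _ (Quotient.exact (s := H.faceSetoid S) hF)).2 he.1) rfl

end EmbeddedMultigraph

/-- The outer walk has a direction forced by the embedding, while `ℓ` may be either end of the path.
-/
theorem IsNoncrossing.reverse {V : Type u} {G : SimpleGraph V} {T : Set V} {ρ : V} {par : V → V}
    {dep : V → ℕ} {p : ℕ → V} {N : ℕ} (h : IsNoncrossing G T ρ par dep p N) :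
    IsNoncrossing G T ρ par dep (fun i => p (N - i)) N := by
  have hatt : ∀ {c i}, i ∈ attachments G T par (fun i => p (N - i)) N c →
      i ≤ N ∧ N - i ∈ attachments G T par p N c := fun ⟨hi, hu⟩ => ⟨hi, Nat.sub_le _ _, hu⟩
  have hatt' : ∀ {c i}, i ∈ attachments G T par p N c →
      N - i ∈ attachments G T par (fun i => p (N - i)) N c := by
    rintro c i ⟨hi, u, hu, ha⟩
    refine ⟨Nat.sub_le _ _, u, hu, ?_⟩
    simpa only [Nat.sub_sub_self hi] using ha
  refine ⟨h.toIsParentFunction, ?_, ?_, ?_, ?_, ?_, ?_⟩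
  · intro i hi j hj hij
    have := h.path_inj _ (Nat.sub_le _ _) _ (Nat.sub_le _ _) hij
    omega
  · exact fun i hi => h.path_notMem _ (Nat.sub_le _ _)
  · intro i hi j hj
    rw [h.path_adj _ (Nat.sub_le _ _) _ (Nat.sub_le _ _)]
    omega
  · intro c hc hne
    obtain ⟨i, hi, j, hj, hij⟩ := h.exists_lt c hc hne
    have := hj.1
    exact ⟨_, hatt' hj, _, hatt' hi, by omega⟩
  · intro c hc hne i hi k hk j hij hjk u hu huc
    have h1 := hatt hi
    have h2 := hatt hk
    exact h.noncrossing c hc hne _ h2.2 _ h1.2 (N - j) (by omega) (by omega) u hu huc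
  · intro c hc hne c' hc' hne' hdisj i hi k hk i' hi' k' hk' j h1 h2 h3 h4
    have a1 := hatt hi
    have a2 := hatt hk
    have a3 := hatt hi'
    have a4 := hatt hk'
    -- Reversal sends the path edge from `j` to `j + 1` to the one from `N - 1 - j` to `N - j`.
    exact h.disjoint c hc hne c' hc' hne' hdisj _ a2.2 _ a1.2 _ a4.2 _ a3.2 (N - 1 - j)
      (by omega) (by omega) (by omega) (by omega)

/-! ### From the embedding to noncrossing attachments. -/

namespace EmbeddedMultigraph

variable {V : Type u} {H : EmbeddedMultigraph V} {outer : H.Face}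

theorem isLinked_descendants {T : Set V} {ρ : V} {par : V → V} {dep : V → ℕ}
    (hpar : IsParentFunction H.toSimple T ρ par dep) (c : V) :
    ∀ (k : ℕ) (u : V), u ∈ T → par^[k] u = c → H.IsLinked (descendants T par c) u c := by
  intro k
  induction k with
  | zero =>
    rintro u - rfl
    exact .refl _ _
  | succ k ih =>
    intro u hu hk
    by_cases huc : u = c
    · subst huc; exact .refl _ _
    have hmem : u ∈ descendants T par c := ⟨hu, _, hk⟩
    have huρ : u ≠ ρ := by
      rintro rfl
      rw [hpar.iterate_root] at hk
      exact huc hk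
    obtain ⟨-, d, h1, h2⟩ :=
      (hpar.adj_iff u hu _ (hpar.par_mem u hu)).2 (Or.inl ⟨huρ, rfl⟩)
    have hlink := IsLinked.of_dart (d := d) (h1.symm ▸ hmem)
      (h2.symm ▸ hpar.par_mem_descendants hmem huc)
    rw [h1, h2] at hlink
    exact hlink.trans (ih _ (hpar.par_mem u hu) hk)

/-- The complement of a subtree is closed under taking parents, so the tree path from the root
avoids the subtree. -/
theorem reflTransGen_root {T : Set V} {ρ : V} {par : V → V} {dep : V → ℕ}
    (hpar : IsParentFunction H.toSimple T ρ par dep) {O : Set V} (hO : ∀ v ∈ T, v ∉ O) (c : V) :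
    ∀ (n : ℕ) (u : V), dep u = n → u ∈ T → u ∉ descendants T par c →
      Relation.ReflTransGen (fun x y => y ∉ descendants T par c ∧ y ∉ O ∧
        ∃ d, H.src d = x ∧ H.tgt d = y) ρ u := by
  intro n
  induction n using Nat.strong_induction_on with
  | _ n ih =>
  intro u hn hu huc
  by_cases huρ : u = ρ
  · subst huρ; exact .refl
  have hp := hpar.par_mem u hu
  have hd := hpar.dep_eq u hu huρ
  obtain ⟨-, d, h1, h2⟩ := (hpar.adj_iff _ hp u hu).2 (Or.inr ⟨huρ, rfl⟩)
  exact .tail (ih _ (by omega) _ rfl hp fun h => huc (IsParentFunction.mem_of_par_mem hu h))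
    ⟨huc, hO u hu, d, h1, h2⟩

/-- The graph `Gr` is a cycle-tree `H` in which only the edge of the outer dart `o N` and edges
between `ρ` and outer vertices may be missing, and `ρ` is incident to the inner face at `o N`. -/
theorem IsOuterWalk.isNoncrossing [Finite V] {N : ℕ} {o : ℕ → H.Dart}
    (hw : H.IsOuterWalk outer N o) (hc : H.IsCycleTree outer) (h3 : H.IsThreeConnected)
    {T : Set V} (hT : T = (H.outerLevel outer)ᶜ)
    {ρ : V} {par : V → V} {dep : V → ℕ} (hpar : IsParentFunction H.toSimple T ρ par dep)
    {dρ : H.Dart} (hdρ : H.src dρ = ρ) (hface : H.faceOf ∅ dρ = H.faceOf ∅ (H.rev (o N)))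
    {Gr : SimpleGraph V} (hle : Gr ≤ H.toSimple)
    (hGr : ∀ u ∈ T, ∀ v, v ∈ T ∨ u ≠ ρ → H.toSimple.Adj u v → Gr.Adj u v)
    (hpath : ∀ i ≤ N, ∀ j ≤ N, Gr.Adj (H.src (o i)) (H.src (o j)) ↔ i + 1 = j ∨ j + 1 = i) :
    IsNoncrossing Gr T ρ par dep (fun i => H.src (o i)) N := by
  have hTO : ∀ {v}, v ∈ T → v ∉ H.outerLevel outer := fun hv => by rwa [hT] at hv
  have hOT : ∀ {v}, v ∉ T → v ∈ H.outerLevel outer := fun hv => by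
    rw [hT] at hv; exact not_not.1 hv
  have hN : 0 < N := by
    rcases Nat.eq_zero_or_pos N with rfl | h
    · refine absurd ?_ (hc.loopless (o 0))
      rw [hw.tgt_eq, hw.period]
    · exact h
  have hGpar : IsParentFunction Gr T ρ par dep :=
    ⟨hpar.root_mem, hpar.par_root, hpar.par_mem, hpar.dep_eq, fun u hu v hv =>
      ⟨fun h => (hpar.adj_iff u hu v hv).1 (hle h),
        fun h => hGr u hu v (Or.inl hv) ((hpar.adj_iff u hu v hv).2 h)⟩⟩
  have hdart : ∀ {c i}, i ∈ attachments Gr T par (fun i => H.src (o i)) N c →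
      i ≤ N ∧ ∃ d, H.src d = H.src (o i) ∧ H.tgt d ∈ descendants T par c := by
    rintro c i ⟨hi, u, hu, ha⟩
    obtain ⟨-, d, rfl, h⟩ := hle ha
    exact ⟨hi, H.rev d, h, by rwa [tgt_rev]⟩
  have hsep : ∀ c ∈ T, c ≠ ρ → ∀ i ∈ attachments Gr T par (fun i => H.src (o i)) N c,
      ∀ k ∈ attachments Gr T par (fun i => H.src (o i)) N c, i < k →
      (∀ j, i < j → j < k → ∀ d, H.src d = H.src (o j) → H.tgt d ∉ H.outerLevel outer →
        H.tgt d ∈ descendants T par c) ∧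
      (∀ j, i ≤ j → j < k → ∀ d, H.src d ∉ H.outerLevel outer →
        H.faceOf ∅ d = H.faceOf ∅ (H.rev (o j)) → H.src d ∈ descendants T par c) := by
    intro c hcT hne i hi k hk hik
    obtain ⟨-, da, hda, hda'⟩ := hdart hi
    obtain ⟨hkN, db, hdb, hdb'⟩ := hdart hk
    refine hw.separation hc h3 (D := descendants T par c) (fun v hv => hTO hv.1) ?_ hik hkN
      hda hda' hdb hdb' (hTO hpar.root_mem) (hpar.root_notMem_descendants hne) hdρ hface ?_
    · rintro u ⟨hu, m, hm⟩ w ⟨hw, m', hm'⟩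
      exact (isLinked_descendants hpar c m u hu hm).trans
        (isLinked_descendants hpar c m' w hw hm').symm
    · intro u huc huO
      exact reflTransGen_root hpar (fun v => hTO) c _ u rfl (by rw [hT]; exact huO) huc
  refine ⟨hGpar, fun i hi j hj => hw.src_inj i hi j hj, fun i _ h => hTO h (hw.src_mem i), hpath,
    ?_, ?_, ?_⟩
  · intro c hcT hne
    by_contra! hcon
    set A := attachments Gr T par (fun i => H.src (o i)) N c with hA
    have hsub : A.Subsingleton := fun i hi j hj => le_antisymm (hcon j hj i hi) (hcon i hi j hj)
    -- With at most one attachment, this set of at most two vertices would separate the subtree at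
    -- `c` from a path vertex outside it.
    have hs : (insert (par c) ((fun i => H.src (o i)) '' A)).ncard ≤ 2 := by
      have h1 := Set.ncard_insert_le (par c) ((fun i => H.src (o i)) '' A)
      have h2 := Set.ncard_le_one_iff_subsingleton.2 (hsub.image (fun i => H.src (o i)))
      omega
    have hnotA : ∃ i ≤ N, i ∉ A := by
      by_cases h0 : 0 ∈ A
      · exact ⟨N, le_rfl, fun h => hN.ne (hsub h0 h)⟩
      · exact ⟨0, Nat.zero_le _, h0⟩
    obtain ⟨i, hi, hiA⟩ := hnotA
    obtain ⟨d, h1, h2, h4⟩ := h3.exists_dart_leaving (K := descendants T par c) hs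
      (IsParentFunction.self_mem hcT) (t := H.src (o i))
      (by
        rintro (h | ⟨j, -, h⟩)
        · have := hpar.dep_eq c hcT hne
          rw [← h] at this
          omega
        · exact hTO hcT (h ▸ hw.src_mem j))
      (fun h => hTO h.1 (hw.src_mem i))
      (by
        rintro (h | ⟨j, hj, h⟩)
        · exact hTO (hpar.par_mem c hcT) (h ▸ hw.src_mem i)
        · exact hiA (hw.src_inj j hj.1 i hi h ▸ hj))
    have hadj : H.toSimple.Adj (H.src d) (H.tgt d) := ⟨hc.loopless d, d, rfl, rfl⟩
    by_cases hdT : H.tgt d ∈ T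
    · exact h4 (Or.inl (hpar.eq_of_adj_of_notMem h1 hdT h2 hadj).2)
    · obtain ⟨j, hj, hjd⟩ := hw.exists_src _ (hOT hdT)
      refine h4 (Or.inr ⟨j, ⟨hj, H.src d, h1, ?_⟩, hjd⟩)
      have hdne : H.src d ≠ ρ := fun h => hpar.root_notMem_descendants hne (h ▸ h1)
      simp only [hjd]
      exact hGr _ h1.1 _ (Or.inr hdne) hadj
  · intro c hcT hne i hi k hk j hij hjk u hu huc ha
    obtain ⟨-, d, rfl, h⟩ := hle ha
    refine huc ?_
    have := (hsep c hcT hne i hi k hk (hij.trans hjk)).1 j hij hjk (H.rev d) h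
    rw [tgt_rev] at this
    exact this (hTO hu)
  · intro c hcT hne c' hcT' hne' hdisj i hi k hk i' hi' k' hk' j h1 h2 h1' h2'
    -- The tree vertex next to `o j` on its inner face would belong to both subtrees by `hsep`.
    have hO : H.src (H.rot (H.rev (H.rot (o j)))) ∉ H.outerLevel outer := by
      rw [H.src_rot]
      exact tgt_rot_notMem hc h3 (hw.face j)
    have hf : H.faceOf ∅ (H.rot (H.rev (H.rot (o j)))) = H.faceOf ∅ (H.rev (o j)) := by
      rw [H.faceOf_rot_rev, H.faceOf_rot]
    exact Set.disjoint_left.1 hdisj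
      ((hsep c hcT hne i hi k hk (h1.trans_lt h2)).2 j h1 h2 _ hO hf)
      ((hsep c' hcT' hne' i' hi' k' hk' (h1'.trans_lt h2')).2 j h1' h2' _ hO hf)

end EmbeddedMultigraph

/-! ### Assembly of the main theorem. -/

open EmbeddedMultigraph in
/-- Every almost-triconnected path-tree has an SPQ-decomposition. -/
theorem mainTheorem4 {V : Type*} [Finite V] (G : PathTreeData V) (hG : G.IsAlmostTriconnected) :
    Nonempty (SPQDecomposition G) := by
  obtain ⟨H, outer, S, e, F, hc, h3, hP, hT, hroot, hleft, hright, -, -, hse, hte, hSrev, heS, hS,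
    hadj, ⟨d₀, hd₀, hd₀F⟩, -, -, hSF⟩ := hG
  rw [hP] at hleft hright
  have hrootO : G.root ∉ H.outerLevel outer := by rw [hT] at hroot; exact hroot
  -- `ε` is the added edge `ℓr` oriented along the outer face, which may be opposite to `e`.
  obtain ⟨ε, hε, heε⟩ : ∃ ε, H.faceOf ∅ ε = outer ∧ (e = ε ∨ e = H.rev ε) := by
    rcases faceOf_eq_outer_or_rev hc h3 (d := e) (hse ▸ hleft) (hte ▸ hright) with h | h
    · exact ⟨e, h, Or.inl rfl⟩
    · exact ⟨H.rev e, h, Or.inr (H.rev_rev e).symm⟩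
  have hSe : ∀ d ∈ S, (d = ε ∨ d = H.rev ε) ∨ (H.src d = G.root ∧ H.tgt d ∈ H.outerLevel outer) ∨
      (H.tgt d = G.root ∧ H.src d ∈ H.outerLevel outer) := by
    intro d hd
    rcases hS d hd with rfl | rfl | h | h
    · exact Or.inl heε
    · refine Or.inl (heε.symm.imp (fun h => ?_) fun h => by rw [h])
      rw [h, H.rev_rev]
    all_goals
      right
      rw [Sym2.eq_iff] at h
      rcases h with h | h
      · exact Or.inl ⟨h.1, by rwa [h.2]⟩
      · exact Or.inr ⟨h.2, by rwa [h.1]⟩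
  obtain ⟨dρ, hdρ, hface⟩ := exists_dart_inner_face (S := S) (e := e) (dρ := d₀) hε heε
    (hd₀ ▸ hrootO) (fun d hd => by
      rcases hSe d hd with h | h | h
      · rcases heε with rfl | rfl
        · exact h.imp id Or.inl
        · rw [H.rev_rev]
          exact h.elim (fun h => Or.inr (Or.inl h)) Or.inl
      · exact Or.inr (Or.inr (Or.inl (h.1.trans hd₀.symm)))
      · exact Or.inr (Or.inr (Or.inr (h.1.trans hd₀.symm))))
    (hd₀F.trans (hSF e heS).symm)
  rw [hd₀] at hdρ
  obtain ⟨N, o, hw, rfl⟩ := exists_isOuterWalk hc h3 hε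
  obtain ⟨par, dep, hpar⟩ := hc.tree.exists_isParentFunction (ρ := G.root) hrootO
  rw [← hT] at hpar
  have hle : G.graph ≤ H.toSimple := by
    intro u v huv
    obtain ⟨d, -, rfl, rfl⟩ := (hadj u v).1 huv
    exact ⟨hc.loopless d, d, rfl, rfl⟩
  have hεO : H.src (o N) ∈ H.outerLevel outer ∧ H.tgt (o N) ∈ H.outerLevel outer :=
    ⟨hw.src_mem N, tgt_mem_outerLevel hε⟩
  have hGr : ∀ u ∈ G.treeVerts, ∀ v, v ∈ G.treeVerts ∨ u ≠ G.root → H.toSimple.Adj u v →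
      G.graph.Adj u v := by
    rintro u hu v hv ⟨-, d, rfl, rfl⟩
    rw [hT] at hu hv
    refine (hadj _ _).2 ⟨d, fun hd => ?_, rfl, rfl⟩
    rcases hSe d hd with (rfl | rfl) | h | h
    · exact hu hεO.1
    · exact hu hεO.2
    · exact hv.elim (fun h' => h' h.2) fun h' => h' h.1
    · exact hu h.2
  have hconsec : ∀ i, i + 1 ≤ N → G.graph.Adj (H.src (o i)) (H.src (o (i + 1))) := by
    intro i hi
    refine (hadj _ _).2 ⟨o i, fun hd => ?_, rfl, hw.tgt_eq i⟩
    rcases hSe _ hd with (h | h) | h | h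
    · have := hw.src_inj i (by omega) N le_rfl (congrArg H.src h)
      omega
    · exact hw.rev_ne hc h3 N i h.symm
    · exact hrootO (h.1 ▸ hw.src_mem i)
    · exact hrootO (h.1 ▸ tgt_mem_outerLevel (hw.face i))
  have hpath : ∀ i ≤ N, ∀ j ≤ N,
      G.graph.Adj (H.src (o i)) (H.src (o j)) ↔ i + 1 = j ∨ j + 1 = i := by
    intro i hi j hj
    constructor
    · intro h
      obtain ⟨d, hd, hds, hdt⟩ := (hadj _ _).1 h
      have hne : d ≠ o N ∧ d ≠ H.rev (o N) := by
        have heS' := hSrev e heS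
        rcases heε with rfl | rfl
        · exact ⟨fun h => hd (h ▸ heS), fun h => hd (h ▸ heS')⟩
        · rw [H.rev_rev] at heS'
          exact ⟨fun h => hd (h ▸ heS'), fun h => hd (h ▸ heS)⟩
      exact (hw.exists_dart_iff hc h3 hi hj hds hdt hne.1 hne.2).imp And.right And.right
    · rintro (rfl | rfl)
      · exact hconsec i hj
      · exact (hconsec j hi).symm
  have hnc := hw.isNoncrossing hc h3 hT hpar hdρ hface hle hGr hpath
  have hN : 0 < N := by
    rcases Nat.eq_zero_or_pos N with rfl | h
    · refine absurd ?_ (hc.loopless (o 0))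
      rw [hw.tgt_eq, hw.period]
    · exact h
  have hPT : G.pathVerts = G.treeVertsᶜ := by rw [hP, hT, compl_compl]
  have himage : G.pathVerts = (fun i => H.src (o i)) '' Set.Icc 0 N := by
    rw [hP]
    refine Set.Subset.antisymm (fun v hv => ?_) ?_
    · obtain ⟨j, hj, rfl⟩ := hw.exists_src v hv
      exact ⟨j, ⟨Nat.zero_le _, hj⟩, rfl⟩
    · rintro _ ⟨j, -, rfl⟩
      exact hw.src_mem j
  have h0 : H.src (o 0) = H.tgt (o N) := by rw [hw.tgt_eq, hw.period]
  -- The path runs from the target of `ε` to its source. For `e = ε` it thus starts at `r` and has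
  -- to be reversed.
  rcases heε with rfl | rfl
  · refine hnc.reverse.nonempty_decomposition hN rfl rfl rfl hPT ?_ hse.symm ?_
    · rw [himage]
      refine Set.Subset.antisymm ?_ ?_
      · rintro _ ⟨j, hj, rfl⟩
        exact ⟨N - j, ⟨Nat.zero_le _, Nat.sub_le _ _⟩, by simp only [Nat.sub_sub_self hj.2]⟩
      · rintro _ ⟨j, -, rfl⟩
        exact ⟨N - j, ⟨Nat.zero_le _, Nat.sub_le _ _⟩, rfl⟩
    · simp only [Nat.sub_self, h0, hte]
  · refine hnc.nonempty_decomposition hN rfl rfl rfl hPT himage ?_ ?_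
    · rw [h0, ← hse]; rfl
    · rw [← hte, tgt_rev]
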